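/- For a finite-dimensional nilpotent associative algebra $J$ over a finite field $\mathbb F_q$, let $1+J$ be the group of formal elements $1+x$ ($x\in J$) with product $(1+x)(1+y)=1+x+y+xy$ (an $\mathbb F_q$-algebra group). It acts on $J$ by conjugation and hence on $\mathrm{Irr}(J,+)$, the set of complex irreducible characters of the additive group of $J$. Say that $1+J$ *satisfies the Fake Degree Conjecture* if there is a bijection $e$ from the set of $(1+J)$-orbits $\Omega$ in $\mathrm{Irr}(J,+)$ onto $\mathrm{Irr}(1+J)$ with $e(\Omega)(1)=|\Omega|^{1/2}$ for every $\Omega$; that is, the irreducible character degrees of $1+J$ are, counting multiplicities, the square roots of the orbit sizes. The Fake Degree Conjecture for $\mathbb F_q$-algebra groups asserts that all $\mathbb F_q$-algebra groups satisfy this. **Theorem.** Let $p$ be any prime. The Fake Degree Conjecture for $\mathbb F_p$-algebra groups is false. More precisely, let $$\pi=\langle x_1,x_2,x_3,x_4 : x_i^p=[[x_j,x_k],x_l]=1 \text{ for all } i,j,k,l\rangle,\qquad z=[x_1,x_2][x_3,x_4]\in Z(\pi),\qquad \widetilde\pi=\pi/\langle z\rangle,$$ and let $I$ and $\widetilde I$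 be the augmentation ideals of $\mathbb F_p[\pi]$ and $\mathbb F_p[\widetilde\pi]$. Both ideals are finite and nilpotent, so that $1+I$ and $1+\widetilde I$ are $\mathbb F_p$-algebra groups, and at least one of these two groups does not satisfy the Fake Degree Conjecture. Writing $k(\cdot)$ for the number of conjugacy classes and $(\cdot)_{\mathrm{ab}}$ for the abelianization: 1. if $1+I$ satisfies the Fake Degree Conjecture, then $|(1+I)_{\mathrm{ab}}|=p^{k(\pi)-1}$; and if $1+\widetilde I$ satisfies it, then $|(1+\widetilde I)_{\mathrm{ab}}|=p^{k(\widetilde\pi)-1}$; 2. $|(1+I)_{\mathrm{ab}}|\cdot p^{k(\widetilde\pi)+1}\le |(1+\widetilde I)_{\mathrm{ab}}|\cdot p^{k(\pi)}$. In particular, if $1+\widetilde I$ satisfies the Fake Degree Conjecture, then $|(1+I)_{\mathrm{ab}}|\le p^{k(\pi)-2}$. -/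

import Mathlib

noncomputable section

namespace FakeDegree

open scoped commutatorElement

/-- A (non-unital, associative) ring `J` is nilpotent if all products of sufficiently many
elements vanish: `J ^ (n + 1) = 0` for some `n`. -/
def IsNilpotentAlgebra (J : Type*) [NonUnitalRing J] : Prop :=
  ∃ n : ℕ, ∀ (x : J) (l : List J), l.length = n → l.foldl (· * ·) x = 0

section AlgebraGroup

variable (F J : Type*) [Field F] [NonUnitalRing J] [Module F J] [IsScalarTower F J J]
  [SMulCommClass F J J]

/-- The `F`-algebra group `1 + J`: the group of units of `F·1 + J` with scalar part `1`.
For nilpotent `J` every `1 + j` is such a unit. -/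
abbrev AlgebraGroup : Type _ := Unitization.unitsFstOne F J

variable {F J}

/-- The conjugation action of `1 + J` on `J`: `g` acts by `a ↦ g a g⁻¹`. -/
def conj (g : AlgebraGroup F J) : J →+ J where
  toFun a := ((g : (Unitization F J)ˣ).val * (a : Unitization F J) *
    ((g⁻¹ : AlgebraGroup F J) : (Unitization F J)ˣ).val).snd
  map_zero' := by simp
  map_add' a b := by rw [Unitization.inr_add, mul_add, add_mul, Unitization.snd_add]

theorem inr_conj (g : AlgebraGroup F J) (a : J) :
    ((conj g a : J) : Unitization F J) = (g : (Unitization F J)ˣ).val * (a : Unitization F J) *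
      ((g⁻¹ : AlgebraGroup F J) : (Unitization F J)ˣ).val := by
  ext
  · simp
  · simp [conj]

theorem conj_one (a : J) : conj (1 : AlgebraGroup F J) a = a := by
  apply Unitization.inr_injective (R := F)
  rw [inr_conj]
  simp

theorem conj_mul (g h : AlgebraGroup F J) (a : J) : conj (g * h) a = conj g (conj h a) := by
  apply Unitization.inr_injective (R := F)
  rw [inr_conj, inr_conj, inr_conj]
  simp [mul_assoc]

/-- The coadjoint action of `1 + J` on the complex characters of the additive group of `J`,
`(g • φ) a = φ (g⁻¹ a g)`. -/
instance coadjointAction : MulAction (AlgebraGroup F J) (AddChar J ℂ) where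
  smul g φ := φ.compAddMonoidHom (conj g⁻¹)
  one_smul φ := by
    ext a
    change φ (conj (1 : AlgebraGroup F J)⁻¹ a) = φ a
    rw [inv_one, conj_one]
  mul_smul g h φ := by
    ext a
    change φ (conj (g * h)⁻¹ a) = φ (conj h⁻¹ (conj g⁻¹ a))
    rw [mul_inv_rev, conj_mul]

theorem coadjoint_apply (g : AlgebraGroup F J) (φ : AddChar J ℂ) (a : J) :
    (g • φ) a = φ (conj g⁻¹ a) := rfl

variable (F J)

/-- The set of `(1 + J)`-orbits in `Irr(J, +)`. -/
def CoadjointOrbit : Type _ :=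
  {Ω : Set (AddChar J ℂ) // ∃ φ : AddChar J ℂ, Ω = MulAction.orbit (AlgebraGroup F J) φ}

end AlgebraGroup

/-- The irreducible complex characters of a finite group `G`. -/
def IrrChar (G : Type*) [Group G] : Type _ :=
  {χ : G → ℂ // ∃ (n : ℕ) (ρ : Representation ℂ G (Fin n → ℂ)),
    ρ.IsIrreducible ∧ χ = ρ.character}

/-- The irreducible character degrees of `1 + J` coincide, counting multiplicities, with the
square roots of the cardinalities of the `(1 + J)`-orbits in `Irr(J, +)`. -/
def HasFakeDegrees (F J : Type*) [Field F] [NonUnitalRing J] [Module F J] [IsScalarTower F J J]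
    [SMulCommClass F J J] : Prop :=
  ∃ e : CoadjointOrbit F J ≃ IrrChar (AlgebraGroup F J),
    ∀ Ω : CoadjointOrbit F J, (e Ω).1 1 = ((Real.sqrt (Nat.card Ω.1) : ℝ) : ℂ)

/-- The Fake Degree Conjecture for `F`-algebra groups. -/
def FakeDegreeConjecture (F : Type) [Field F] : Prop :=
  ∀ (J : Type) [NonUnitalRing J] [Module F J] [IsScalarTower F J J] [SMulCommClass F J J]
    [Finite J], IsNilpotentAlgebra J → HasFakeDegrees F J

/-- The augmentation ideal of the group algebra `F[G]`, as a non-unital `F`-algebra. -/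
def augmentationIdeal (F G : Type*) [Field F] [Group G] :
    NonUnitalSubalgebra F (MonoidAlgebra F G) where
  carrier := {x | MonoidAlgebra.lift F F G 1 x = 0}
  zero_mem' := map_zero _
  add_mem' {x y} hx hy := by
    simp only [Set.mem_ofPred_eq] at hx hy ⊢
    rw [map_add, hx, hy, add_zero]
  mul_mem' {x y} hx hy := by
    simp only [Set.mem_ofPred_eq] at hx hy ⊢
    rw [map_mul, hx, zero_mul]
  smul_mem' c x hx := by
    simp only [Set.mem_ofPred_eq] at hx ⊢
    rw [map_smul, hx, smul_zero]

/-- The group `1 + I` of normalized units of the group algebra `F[G]`. -/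
abbrev NormalizedUnits (F G : Type*) [Field F] [Group G] : Type _ :=
  AlgebraGroup F (augmentationIdeal F G)

/-- The number of conjugacy classes of `G`. -/
def classNumber (G : Type*) [Group G] : ℕ := Nat.card (ConjClasses G)

/-- The relators `x_i ^ p` and `[[x_j, x_k], x_l]`. -/
def relators (p : ℕ) : Set (FreeGroup (Fin 4)) :=
  {r | ∃ i : Fin 4, r = FreeGroup.of i ^ p} ∪
    {r | ∃ j k l : Fin 4, r = ⁅⁅FreeGroup.of j, FreeGroup.of k⁆, FreeGroup.of l⁆}

/-- The group `π = ⟨x₁, x₂, x₃, x₄ : x_i ^ p = [x_j, x_k, x_l] = 1⟩`. -/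
abbrev PiGroup (p : ℕ) : Type := PresentedGroup (relators p)

/-- The central element `z = [x₁, x₂][x₃, x₄]` of `π`. -/
def zElement (p : ℕ) : PiGroup p :=
  ⁅(PresentedGroup.of 0 : PiGroup p), (PresentedGroup.of 1 : PiGroup p)⁆ *
    ⁅(PresentedGroup.of 2 : PiGroup p), (PresentedGroup.of 3 : PiGroup p)⁆

/-- The quotient `π / ⟨z⟩`; as `z` is central, `⟨z⟩` is the normal closure of `z`. -/
abbrev PiTilde (p : ℕ) : Type := PiGroup p ⧸ Subgroup.normalClosure {zElement p}

end FakeDegree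

end

/-!
If `1 + J` satisfies the Fake Degree Conjecture, its linear characters are as many as the coadjoint
fixed points in `Irr(J, +)`. These fixed points are the trace functions, so they are counted by the
cocenter `J / [J, J]`, and `|(1 + J)_ab| = |J / [J, J]|`. For the augmentation ideal `I` of `F[G]`,
with `q = |F|`, the cocenter has order `q ^ (k(G) - 1)`.

Now let `z` be a central element of order `p` in the commutator subgroup of `G`, and let
`Q = G / ⟨z⟩`. The element `t = z - 1` of `R = F[G]` is central and nilpotent with
`R / tR = F[Q]`. Filter the kernel of `R*_ab → F[Q]*_ab` by the images of the congruence subgroups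
`1 + t ^ i R`. Each quotient is a quotient of the cocenter of `F[Q]`, of order `q ^ k(Q)`, through
`a ↦ 1 + t ^ i a`. Since `z = 1 + t` dies in `R*_ab`, the first of the `p - 1` steps loses a factor
`p`.

For `G = π` no power of `z` except `1` is a commutator: the exponents of the `[x_i, x_j]` in a
commutator are the `2 × 2` minors of a `2 × 4` matrix, and the Plücker relation excludes
`(n, 0, 0, 0, 0, n)`. Hence every class of `π / ⟨z⟩` lifts to `p` classes, `k(π) = p k(π / ⟨z⟩)`,
and the bound contradicts the two orders that the conjecture predicts.
-/

noncomputable section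

namespace FakeDegree

open scoped commutatorElement

section Cocenter

/-- The additive subgroup `[J, J]` of `J` generated by the ring commutators `a * b - b * a`. -/
def ringCommutator (J : Type*) [NonUnitalRing J] : AddSubgroup J :=
  AddSubgroup.closure {x | ∃ a b, a * b - b * a = x}

/-- The cocenter `J / [J, J]`, through which all trace functions on `J` factor. -/
abbrev Cocenter (J : Type*) [NonUnitalRing J] : Type _ := J ⧸ ringCommutator J

variable {J K : Type*} [NonUnitalRing J] [NonUnitalRing K]

theorem mul_sub_mul_mem_ringCommutator (a b : J) : a * b - b * a ∈ ringCommutator J :=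
  AddSubgroup.subset_closure ⟨a, b, rfl⟩

theorem ringCommutator_le_ker_iff {A : Type*} [AddMonoid A] {f : J →+ A} :
    ringCommutator J ≤ f.ker ↔ ∀ a b, f (a * b) = f (b * a) := by
  constructor
  · intro h a b
    rw [← sub_add_cancel (a * b) (b * a), map_add,
      AddMonoidHom.mem_ker.1 (h (mul_sub_mul_mem_ringCommutator a b)), zero_add]
  · intro h
    refine (AddSubgroup.closure_le _).2 ?_
    rintro _ ⟨a, b, rfl⟩
    rw [SetLike.mem_coe, AddMonoidHom.mem_ker, sub_eq_add_neg, map_add, h, ← map_add,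
      add_neg_cancel, map_zero]

theorem map_mem_ringCommutator (f : J →ₙ+* K) {x : J} (hx : x ∈ ringCommutator J) :
    f x ∈ ringCommutator K := by
  suffices h : ringCommutator J ≤ (ringCommutator K).comap (f : J →+ K) from h hx
  refine (AddSubgroup.closure_le _).2 ?_
  rintro _ ⟨a, b, rfl⟩
  simpa using mul_sub_mul_mem_ringCommutator (f a) (f b)

theorem map_ringCommutator_of_surjective {f : J →ₙ+* K} (hf : Function.Surjective f) :
    (ringCommutator J).map (f : J →+ K) = ringCommutator K := by
  refine le_antisymm (AddSubgroup.map_le_iff_le_comap.2 fun x => map_mem_ringCommutator f) ?_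
  refine (AddSubgroup.closure_le _).2 ?_
  rintro _ ⟨a, b, rfl⟩
  obtain ⟨a, rfl⟩ := hf a
  obtain ⟨b, rfl⟩ := hf b
  exact ⟨a * b - b * a, mul_sub_mul_mem_ringCommutator a b, by simp⟩

theorem one_notMem_ringCommutator {R S : Type*} [Ring R] [CommRing S] [Nontrivial S]
    (f : R →+* S) : (1 : R) ∉ ringCommutator R := fun h =>
  one_ne_zero ((map_one f).symm.trans <| ringCommutator_le_ker_iff (f := (f : R →+ S)).2
    (fun a b => by simp [mul_comm]) h)

theorem card_cocenter_congr (e : J ≃+* K) : Nat.card (Cocenter J) = Nat.card (Cocenter K) :=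
  Nat.card_congr (QuotientAddGroup.congr _ _ e.toAddEquiv
    (map_ringCommutator_of_surjective (f := (e : J →ₙ+* K)) e.surjective)).toEquiv

theorem card_cocenter_unitization (F J : Type*) [CommRing F] [NonUnitalRing J] [Module F J]
    [IsScalarTower F J J] [SMulCommClass F J J] :
    Nat.card (Cocenter (Unitization F J)) = Nat.card F * Nat.card (Cocenter J) := by
  let f : Unitization F J →+ F × Cocenter J :=
    ((AddMonoidHom.id F).prodMap (QuotientAddGroup.mk' (ringCommutator J))).comp
      (Unitization.addEquiv F J)
  have hf : Function.Surjective f :=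
    (Function.surjective_id.prodMap (QuotientAddGroup.mk'_surjective _)).comp
      (Unitization.addEquiv F J).surjective
  have hker : ringCommutator (Unitization F J) = f.ker := by
    refine le_antisymm (ringCommutator_le_ker_iff.2 fun a b => Prod.ext ?_ ?_) fun x hx => ?_
    · exact mul_comm a.fst b.fst
    · have hsnd : (a * b).snd - (b * a).snd = a.snd * b.snd - b.snd * a.snd := by
        rw [Unitization.snd_mul, Unitization.snd_mul]
        abel
      exact QuotientAddGroup.eq_iff_sub_mem.2 (hsnd ▸ mul_sub_mul_mem_ringCommutator a.snd b.snd)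
    · have hfst : x.fst = 0 := congrArg Prod.fst hx
      have hsnd : x.snd ∈ ringCommutator J :=
        (QuotientAddGroup.eq_zero_iff _).1 (congrArg Prod.snd hx)
      rw [← Unitization.inl_fst_add_inr_snd_eq x, hfst, Unitization.inl_zero, zero_add]
      exact map_mem_ringCommutator
        (NonUnitalRingHomClass.toNonUnitalRingHom (Unitization.inrNonUnitalAlgHom F J)) hsnd
  rw [← Nat.card_prod, Cocenter, hker]
  exact Nat.card_congr (QuotientAddGroup.quotientKerEquivOfSurjective f hf).toEquiv

/-- The additive characters of `J` that are trace functions are the characters of the cocenter. -/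
def traceCharEquiv (J : Type*) [NonUnitalRing J] :
    {φ : AddChar J ℂ // ∀ a b, φ (a * b) = φ (b * a)} ≃ AddChar (Cocenter J) ℂ where
  toFun φ := AddChar.toAddMonoidHomEquiv.symm <| QuotientAddGroup.lift (ringCommutator J)
    (AddChar.toAddMonoidHomEquiv φ.1) (ringCommutator_le_ker_iff.2 φ.2)
  invFun ψ := ⟨ψ.compAddMonoidHom (QuotientAddGroup.mk' _), fun a b => congrArg ψ <|
    QuotientAddGroup.eq_iff_sub_mem.2 (mul_sub_mul_mem_ringCommutator a b)⟩
  left_inv _ := rfl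
  right_inv ψ := by
    ext x
    obtain ⟨x, rfl⟩ := QuotientAddGroup.mk_surjective x
    rfl

theorem card_traceChar (J : Type*) [NonUnitalRing J] [Finite J] :
    Nat.card {φ : AddChar J ℂ // ∀ a b, φ (a * b) = φ (b * a)} = Nat.card (Cocenter J) := by
  have := Fintype.ofFinite (Cocenter J)
  rw [Nat.card_congr (traceCharEquiv J), Nat.card_eq_fintype_card, AddChar.card_eq,
    Nat.card_eq_fintype_card]

theorem mapDomain_surjective {R X Y : Type*} [Semiring R] {f : X → Y}
    (hf : Function.Surjective f) :
    Function.Surjective (MonoidAlgebra.mapDomain f : MonoidAlgebra R X → MonoidAlgebra R Y) :=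
  MonoidAlgebra.coeffEquiv.symm.surjective.comp
    ((Finsupp.mapDomain_surjective hf).comp MonoidAlgebra.coeffEquiv.surjective)

theorem mem_of_mapDomain_eq_zero {R X Y : Type*} [Ring R] {f : X → Y}
    (hf : Function.Surjective f) {N : AddSubgroup (MonoidAlgebra R X)}
    (hN : ∀ a b r, f a = f b → MonoidAlgebra.single a r - MonoidAlgebra.single b r ∈ N)
    {x : MonoidAlgebra R X} (hx : MonoidAlgebra.mapDomain f x = 0) : x ∈ N := by
  suffices h : ∀ x : MonoidAlgebra R X,
      x - MonoidAlgebra.mapDomain (Function.surjInv hf) (MonoidAlgebra.mapDomain f x) ∈ N by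
    simpa [hx] using h x
  intro x
  induction x using MonoidAlgebra.induction_linear with
  | zero => simp
  | add x y hx hy =>
    rw [MonoidAlgebra.mapDomain_add, MonoidAlgebra.mapDomain_add, add_sub_add_comm]
    exact N.add_mem hx hy
  | single a r =>
    rw [MonoidAlgebra.mapDomain_single, MonoidAlgebra.mapDomain_single]
    exact hN _ _ _ (Function.surjInv_eq hf (f a)).symm

theorem single_sub_single_mem_ringCommutator {R G : Type*} [Ring R] [Group G] {g h : G}
    (hgh : IsConj g h) (r : R) :
    MonoidAlgebra.single g r - MonoidAlgebra.single h r ∈ ringCommutator (MonoidAlgebra R G) := by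
  obtain ⟨c, rfl⟩ := isConj_iff.1 hgh
  convert mul_sub_mul_mem_ringCommutator
    (MonoidAlgebra.single c⁻¹ 1) (MonoidAlgebra.single (c * g) r) using 2 <;>
  simp [MonoidAlgebra.single_mul_single]

theorem card_cocenter_monoidAlgebra (R G : Type*) [CommRing R] [Group G] [Finite G] :
    Nat.card (Cocenter (MonoidAlgebra R G)) = Nat.card R ^ classNumber G := by
  let f : MonoidAlgebra R G →+ MonoidAlgebra R (ConjClasses G) :=
    { toFun := MonoidAlgebra.mapDomain ConjClasses.mk
      map_zero' := MonoidAlgebra.mapDomain_zero _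
      map_add' := MonoidAlgebra.mapDomain_add _ }
  have hf : Function.Surjective f := mapDomain_surjective ConjClasses.mk_surjective
  have hker : ringCommutator (MonoidAlgebra R G) = f.ker := by
    refine le_antisymm (ringCommutator_le_ker_iff.2 fun a b => ?_) fun x hx =>
      mem_of_mapDomain_eq_zero ConjClasses.mk_surjective
        (fun g h r hgh => single_sub_single_mem_ringCommutator
          (ConjClasses.mk_eq_mk_iff_isConj.1 hgh) r) hx
    induction a using MonoidAlgebra.induction_linear with
    | zero => simp
    | add x y hx hy => rw [add_mul, mul_add, map_add, map_add, hx, hy]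
    | single g r =>
      induction b using MonoidAlgebra.induction_linear with
      | zero => simp
      | add x y hx hy => rw [add_mul, mul_add, map_add, map_add, hx, hy]
      | single h s =>
        have hconj : ConjClasses.mk (g * h) = ConjClasses.mk (h * g) :=
          ConjClasses.mk_eq_mk_iff_isConj.2 (isConj_iff.2 ⟨h, by group⟩)
        simp [f, MonoidAlgebra.single_mul_single, hconj, mul_comm]
  rw [Cocenter, hker, Nat.card_congr (QuotientAddGroup.quotientKerEquivOfSurjective f hf).toEquiv,
    Nat.card_congr (MonoidAlgebra.coeffEquiv.trans Finsupp.equivFunOnFinite), Nat.card_fun,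
    classNumber]

end Cocenter

section LinearCharacters

variable {k G : Type*} [Field k] [Group G]

theorem isIrreducible_of_finrank_eq_one {V : Type*} [AddCommGroup V] [Module k V]
    (ρ : Representation k G V) (hV : Module.finrank k V = 1) : ρ.IsIrreducible := by
  have hsimple := (isSimpleModule_iff k V).1 (isSimpleModule_iff_finrank_eq_one.2 hV)
  exact
    { exists_pair_ne := ⟨⊥, ⊤, fun h => bot_ne_top (congrArg Subrepresentation.toSubmodule h)⟩
      eq_bot_or_eq_top := fun W => (hsimple.eq_bot_or_eq_top W.toSubmodule).imp
        (fun h => Subrepresentation.toSubmodule_injective h)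
        (fun h => Subrepresentation.toSubmodule_injective h) }

theorem trace_eq_det_of_fin_one {R : Type*} [CommRing R] (f : (Fin 1 → R) →ₗ[R] Fin 1 → R) :
    LinearMap.trace R _ f = LinearMap.det f := by
  rw [LinearMap.trace_eq_matrix_trace R (Pi.basisFun R (Fin 1)), Matrix.trace_fin_one,
    LinearMap.toMatrix_eq_toMatrix', ← LinearMap.det_toMatrix', Matrix.det_fin_one]

/-- The one-dimensional representation in which `G` acts through the scalars `f g`. -/
def linearRep (f : G →* kˣ) : Representation k G (Fin 1 → k) :=
  (algebraMap k (Module.End k (Fin 1 → k)) : k →* _).comp ((Units.coeHom k).comp f)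

theorem character_linearRep (f : G →* kˣ) (g : G) : (linearRep f).character g = f g := by
  change LinearMap.trace k (Fin 1 → k) (algebraMap k (Module.End k (Fin 1 → k)) (f g)) = f g
  simp [Module.algebraMap_end_eq_smul_id]

theorem exists_character_linearRep_eq (ρ : Representation k G (Fin 1 → k)) :
    ∃ f : G →* kˣ, (linearRep f).character = ρ.character := by
  refine ⟨(LinearMap.det.comp ρ).toHomUnits, funext fun g => ?_⟩
  rw [character_linearRep]
  exact (trace_eq_det_of_fin_one (ρ g)).symm

theorem card_irrChar_degree_one (G : Type*) [Group G] [Finite G] :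
    Nat.card {χ : IrrChar G // χ.1 1 = 1} = Nat.card (Abelianization G) := by
  let toIrrChar (f : G →* ℂˣ) : {χ : IrrChar G // χ.1 1 = 1} :=
    ⟨⟨_, 1, linearRep f, isIrreducible_of_finrank_eq_one _ (by simp), rfl⟩, by simp⟩
  have hbij : Function.Bijective toIrrChar := by
    refine ⟨fun f f' h => MonoidHom.ext fun g => Units.ext ?_, ?_⟩
    · have hchar : (linearRep f).character = (linearRep f').character :=
        congrArg (fun χ => χ.1.1) h
      rw [← character_linearRep, hchar, character_linearRep]
    · rintro ⟨⟨χ, n, ρ, hρ, rfl⟩, hdeg⟩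
      obtain rfl : n = 1 := by simpa [Representation.char_one] using hdeg
      obtain ⟨f, hf⟩ := exists_character_linearRep_eq ρ
      exact ⟨f, Subtype.ext (Subtype.ext hf)⟩
  rw [← Nat.card_congr (Equiv.ofBijective toIrrChar hbij),
    Nat.card_congr (Abelianization.lift (G := G) (A := ℂˣ)),
    CommGroup.card_monoidHom_of_hasEnoughRootsOfUnity (Abelianization G) ℂ]

end LinearCharacters

section FixedPoints

theorem map_foldl_mul {J M : Type*} [Mul J] [Monoid M] (f : J →ₙ* M) (x : J) (l : List J) :
    f (l.foldl (· * ·) x) = f x * (l.map f).prod := by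
  induction l generalizing x with
  | nil => simp
  | cons a l ih => rw [List.foldl_cons, ih, map_mul, List.map_cons, List.prod_cons, mul_assoc]

theorem IsNilpotentAlgebra.isNilpotent_map {J R : Type*} [NonUnitalRing J] [Semiring R]
    (hJ : IsNilpotentAlgebra J) (f : J →ₙ+* R) (x : J) : IsNilpotent (f x) := by
  obtain ⟨n, hn⟩ := hJ
  have hpow := map_foldl_mul (f : J →ₙ* R) x (List.replicate n x)
  rw [hn x _ (List.length_replicate ..)] at hpow
  exact ⟨n + 1, by simpa [pow_succ'] using hpow.symm⟩

variable {F J : Type*} [Field F] [NonUnitalRing J] [Module F J] [IsScalarTower F J J]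
  [SMulCommClass F J J]

theorem algebraGroup_val (g : AlgebraGroup F J) :
    g.1.val = 1 + (g.1.val.snd : Unitization F J) := by
  ext <;> simp

theorem IsNilpotentAlgebra.exists_algebraGroup_snd_eq (hJ : IsNilpotentAlgebra J) (x : J) :
    ∃ g : AlgebraGroup F J, g.1.val.snd = x := by
  have hx : IsNilpotent (x : Unitization F J) := hJ.isNilpotent_map
    (NonUnitalRingHomClass.toNonUnitalRingHom (Unitization.inrNonUnitalAlgHom F J)) x
  exact ⟨⟨hx.isUnit_one_add.unit, by simp⟩, by simp⟩

theorem inr_add_mul_snd (g : AlgebraGroup F J) (a : J) :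
    ((a + a * g.1.val.snd : J) : Unitization F J) = a * g.1.val := by
  conv_rhs => rw [algebraGroup_val g, mul_add, mul_one]
  rw [Unitization.inr_add, Unitization.inr_mul]

theorem conj_add_mul_snd (g : AlgebraGroup F J) (a : J) :
    conj g (a + a * g.1.val.snd) = a + g.1.val.snd * a := by
  apply Unitization.inr_injective (R := F)
  rw [inr_conj, inr_add_mul_snd, Subgroup.coe_inv, mul_assoc, mul_assoc, Units.mul_inv, mul_one]
  conv_lhs => rw [algebraGroup_val g, add_mul, one_mul]
  rw [Unitization.inr_add, Unitization.inr_mul]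

theorem exists_add_mul_snd_eq (g : AlgebraGroup F J) (b : J) :
    ∃ a, a + a * g.1.val.snd = b := by
  refine ⟨b + b * (g⁻¹).1.val.snd, Unitization.inr_injective (R := F) ?_⟩
  rw [inr_add_mul_snd, inr_add_mul_snd, Subgroup.coe_inv, Units.inv_mul_cancel_right]

theorem inv_smul_eq_self_iff (g : AlgebraGroup F J) (φ : AddChar J ℂ) :
    g⁻¹ • φ = φ ↔ ∀ a, φ (g.1.val.snd * a) = φ (a * g.1.val.snd) := by
  have hcancel (a : J) : φ (conj g (a + a * g.1.val.snd)) = φ (a + a * g.1.val.snd) ↔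
      φ (g.1.val.snd * a) = φ (a * g.1.val.snd) := by
    rw [conj_add_mul_snd, φ.map_add_eq_mul, φ.map_add_eq_mul,
      mul_right_inj' (φ.val_isUnit a).ne_zero]
  simp_rw [DFunLike.ext_iff, coadjoint_apply, inv_inv, ← hcancel]
  refine ⟨fun h a => h _, fun h b => ?_⟩
  obtain ⟨a, rfl⟩ := exists_add_mul_snd_eq g b
  exact h a

theorem IsNilpotentAlgebra.mem_fixedPoints_iff (hJ : IsNilpotentAlgebra J) (φ : AddChar J ℂ) :
    φ ∈ MulAction.fixedPoints (AlgebraGroup F J) (AddChar J ℂ) ↔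
      ∀ a b, φ (a * b) = φ (b * a) := by
  refine ⟨fun h a b => ?_, fun h g => ?_⟩
  · obtain ⟨g, rfl⟩ := hJ.exists_algebraGroup_snd_eq (F := F) a
    exact (inv_smul_eq_self_iff g φ).1 (h g⁻¹) b
  · exact inv_inv g ▸ (inv_smul_eq_self_iff g⁻¹ φ).2 (h _)

theorem card_coadjointOrbit_card_eq_one (F J : Type*) [Field F] [NonUnitalRing J] [Module F J]
    [IsScalarTower F J J] [SMulCommClass F J J] :
    Nat.card {Ω : CoadjointOrbit F J // Nat.card Ω.1 = 1} =
      Nat.card (MulAction.fixedPoints (AlgebraGroup F J) (AddChar J ℂ)) := by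
  have hcard (φ : AddChar J ℂ) : Nat.card (MulAction.orbit (AlgebraGroup F J) φ) = 1 ↔
      φ ∈ MulAction.fixedPoints (AlgebraGroup F J) (AddChar J ℂ) := by
    rw [← MulAction.subsingleton_orbit_iff_mem_fixedPoints, Nat.card_eq_one_iff_unique,
      Set.subsingleton_coe]
    exact and_iff_left ⟨⟨φ, MulAction.mem_orbit_self φ⟩⟩
  refine (Nat.card_congr (Equiv.ofBijective (fun φ =>
    ⟨⟨MulAction.orbit (AlgebraGroup F J) φ.1, φ.1, rfl⟩, (hcard φ.1).2 φ.2⟩) ⟨?_, ?_⟩)).symm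
  · intro φ ψ h
    have horbit : MulAction.orbit (AlgebraGroup F J) φ.1 = MulAction.orbit (AlgebraGroup F J) ψ.1 :=
      congrArg (fun Ω => Ω.1.1) h
    exact Subtype.ext (MulAction.mem_fixedPoints'.1 ψ.2 _ (MulAction.orbit_eq_iff.1 horbit))
  · rintro ⟨⟨_, φ, rfl⟩, h⟩
    exact ⟨⟨φ, (hcard φ).1 h⟩, rfl⟩

theorem HasFakeDegrees.card_abelianization [Finite F] [Finite J] (h : HasFakeDegrees F J)
    (hJ : IsNilpotentAlgebra J) :
    Nat.card (Abelianization (AlgebraGroup F J)) = Nat.card (Cocenter J) := by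
  obtain ⟨e, he⟩ := h
  have : Finite (Unitization F J) := Finite.of_equiv _ (Unitization.addEquiv F J).symm.toEquiv
  have hdegree (Ω : CoadjointOrbit F J) : Nat.card Ω.1 = 1 ↔ (e Ω).1 1 = 1 := by
    rw [he, Complex.ofReal_eq_one, Real.sqrt_eq_one, Nat.cast_eq_one]
  calc Nat.card (Abelianization (AlgebraGroup F J))
    _ = Nat.card {Ω : CoadjointOrbit F J // Nat.card Ω.1 = 1} := by
      rw [← card_irrChar_degree_one]
      exact (Nat.card_congr (e.subtypeEquiv hdegree)).symm
    _ = Nat.card {φ : AddChar J ℂ // ∀ a b, φ (a * b) = φ (b * a)} := by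
      rw [card_coadjointOrbit_card_eq_one]
      exact Nat.card_congr (Equiv.subtypeEquivRight hJ.mem_fixedPoints_iff)
    _ = Nat.card (Cocenter J) := card_traceChar J

end FixedPoints

section AugmentationIdeal

theorem isNilpotentAlgebra_of_forall_map_mem {J R : Type*} [NonUnitalRing J] [Ring R]
    {f : J →ₙ+* R} (hf : Function.Injective f) {I : Ideal R} (hI : IsNilpotent I)
    (hfI : ∀ x, f x ∈ I) : IsNilpotentAlgebra J := by
  have hmem (x : J) (l : List J) : f (l.foldl (· * ·) x) ∈ I ^ (l.length + 1) := by
    induction l using List.reverseRecOn with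
    | nil => exact (Submodule.pow_one I).symm ▸ hfI x
    | append_singleton l a ih =>
      rw [List.foldl_append, List.foldl_cons, List.foldl_nil, map_mul, List.length_append,
        List.length_singleton, Submodule.pow_succ]
      exact Ideal.mul_mem_mul ih (hfI a)
  obtain ⟨n, hn⟩ := hI
  refine ⟨n, fun x l hl => hf ?_⟩
  simpa [hl, Submodule.pow_succ, hn] using hmem x l

instance finite_monoidAlgebra (R X : Type*) [Semiring R] [Finite R] [Finite X] :
    Finite (MonoidAlgebra R X) :=
  Finite.of_equiv _ (MonoidAlgebra.coeffEquiv.trans Finsupp.equivFunOnFinite).symm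

/-- The augmentation map of the group algebra, sending every group element to `1`. -/
abbrev augmentation (F G : Type*) [Field F] [Group G] : MonoidAlgebra F G →ₐ[F] F :=
  MonoidAlgebra.lift F F G 1

variable {F G : Type*} [Field F] [Group G]

theorem mem_augmentationIdeal {x : MonoidAlgebra F G} :
    x ∈ augmentationIdeal F G ↔ augmentation F G x = 0 := Iff.rfl

theorem smul_eq_augmentation_smul {M : Type*} [AddCommGroup M] [Module (MonoidAlgebra F G) M]
    {v : M} (hv : ∀ g : G, MonoidAlgebra.of F G g • v = v) (a : MonoidAlgebra F G) :
    a • v = algebraMap F (MonoidAlgebra F G) (augmentation F G a) • v := by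
  induction a using MonoidAlgebra.induction_linear with
  | zero => simp
  | add x y hx hy => rw [add_smul, hx, hy, map_add, map_add, add_smul]
  | single g r =>
    have hsingle : MonoidAlgebra.single g r =
        algebraMap F (MonoidAlgebra F G) r * MonoidAlgebra.of F G g := by simp
    rw [hsingle, mul_smul, hv, ← hsingle]
    simp

section PGroup

variable {p : ℕ} [Fact p.Prime] [CharP F p]

theorem exists_ne_zero_forall_of_smul_eq (F : Type*) [Field F] [CharP F p]
    (hG : IsPGroup p G) (M : Type*) [AddCommGroup M] [Module (MonoidAlgebra F G) M] [Finite M]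
    [Nontrivial M] :
    ∃ v : M, v ≠ 0 ∧ ∀ g : G, MonoidAlgebra.of F G g • v = v := by
  let _ : MulAction G M := MulAction.compHom M (MonoidAlgebra.of F G)
  have hp (v : M) : p • v = 0 := by
    rw [← Nat.cast_smul_eq_nsmul (MonoidAlgebra F G),
      ← map_natCast (algebraMap F (MonoidAlgebra F G)), CharP.cast_eq_zero, map_zero, zero_smul]
  have hdvd : p ∣ Nat.card M := by
    obtain ⟨v, hv⟩ := exists_ne (0 : M)
    exact addOrderOf_eq_prime (hp v) hv ▸ addOrderOf_dvd_natCard v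
  obtain ⟨v, hv, hv0⟩ := hG.exists_fixed_point_of_prime_dvd_card_of_fixed_point M hdvd
    (a := (0 : M)) (fun g => smul_zero (MonoidAlgebra.of F G g))
  exact ⟨v, hv0.symm, hv⟩

theorem augmentationIdeal_le_jacobson [Finite F] [Finite G] (hG : IsPGroup p G)
    {a : MonoidAlgebra F G} (ha : a ∈ augmentationIdeal F G) :
    a ∈ Ideal.jacobson (⊥ : Ideal (MonoidAlgebra F G)) := by
  refine Submodule.mem_sInf.2 ?_
  rintro m ⟨-, hm⟩
  have hsimple : IsSimpleModule (MonoidAlgebra F G) (MonoidAlgebra F G ⧸ m) :=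
    isSimpleModule_iff_isCoatom.2 hm.out
  have : Finite (MonoidAlgebra F G ⧸ m) := Quotient.finite _
  have : Nontrivial (MonoidAlgebra F G ⧸ m) := IsSimpleModule.nontrivial (MonoidAlgebra F G) _
  obtain ⟨v, hv0, hv⟩ := exists_ne_zero_forall_of_smul_eq F hG (MonoidAlgebra F G ⧸ m)
  obtain ⟨r, hr⟩ := Submodule.mem_span_singleton.1
    (IsSimpleModule.span_singleton_eq_top (MonoidAlgebra F G) hv0 ▸ Submodule.mem_top :
      (Submodule.Quotient.mk 1 : MonoidAlgebra F G ⧸ m) ∈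
        Submodule.span (MonoidAlgebra F G) {v})
  have hzero : a • (Submodule.Quotient.mk 1 : MonoidAlgebra F G ⧸ m) = 0 := by
    rw [← hr, ← mul_smul, smul_eq_augmentation_smul hv, map_mul, mem_augmentationIdeal.1 ha,
      zero_mul, map_zero, zero_smul]
  rwa [← Submodule.Quotient.mk_smul, smul_eq_mul, mul_one, Submodule.Quotient.mk_eq_zero] at hzero

theorem isNilpotentAlgebra_augmentationIdeal [Finite F] [Finite G] (hG : IsPGroup p G) :
    IsNilpotentAlgebra (augmentationIdeal F G) :=
  isNilpotentAlgebra_of_forall_map_mem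
    (f := NonUnitalRingHomClass.toNonUnitalRingHom
      (NonUnitalSubalgebraClass.subtype (augmentationIdeal F G)))
    Subtype.val_injective IsArtinianRing.isNilpotent_jacobson_bot
    fun x => augmentationIdeal_le_jacobson hG x.2

end PGroup

variable (F G)

/-- The homomorphism `(r, x) ↦ r + x` from the unitization of the augmentation ideal to the group
algebra. -/
def unitizationHom : Unitization F (augmentationIdeal F G) →ₐ[F] MonoidAlgebra F G :=
  Unitization.lift (NonUnitalSubalgebraClass.subtype (augmentationIdeal F G))

variable {F G}

theorem unitizationHom_apply (x : Unitization F (augmentationIdeal F G)) :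
    unitizationHom F G x = algebraMap F _ x.fst + x.snd := by
  simp [unitizationHom]

theorem augmentation_unitizationHom (x : Unitization F (augmentationIdeal F G)) :
    augmentation F G (unitizationHom F G x) = x.fst := by
  rw [unitizationHom_apply, map_add, AlgHom.commutes, mem_augmentationIdeal.1 x.snd.2, add_zero]
  rfl

theorem unitizationHom_bijective : Function.Bijective (unitizationHom F G) := by
  constructor
  · intro x y hxy
    have hfst : x.fst = y.fst := by
      rw [← augmentation_unitizationHom, hxy, augmentation_unitizationHom]
    rw [unitizationHom_apply, unitizationHom_apply, hfst] at hxy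
    exact Unitization.ext hfst (Subtype.ext (add_left_cancel hxy))
  · intro a
    have ha : a - algebraMap F _ (augmentation F G a) ∈ augmentationIdeal F G := by
      rw [mem_augmentationIdeal, map_sub, AlgHom.commutes]
      simp
    refine ⟨Unitization.inl (augmentation F G a) + Unitization.inr ⟨_, ha⟩, ?_⟩
    rw [unitizationHom_apply]
    simp

variable (F G)

/-- The decomposition `F ⊕ I = F[G]` of the group algebra. -/
def unitizationEquiv : Unitization F (augmentationIdeal F G) ≃ₐ[F] MonoidAlgebra F G :=
  AlgEquiv.ofBijective (unitizationHom F G) unitizationHom_bijective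

theorem card_cocenter_augmentationIdeal [Finite F] [Finite G] :
    Nat.card (Cocenter (augmentationIdeal F G)) = Nat.card F ^ (classNumber G - 1) := by
  have hclass : 0 < classNumber G := Nat.card_pos
  have hmul : Nat.card F * Nat.card (Cocenter (augmentationIdeal F G)) =
      Nat.card F * Nat.card F ^ (classNumber G - 1) := by
    rw [← card_cocenter_unitization, card_cocenter_congr (unitizationEquiv F G).toRingEquiv,
      card_cocenter_monoidAlgebra, ← pow_succ', Nat.sub_add_cancel hclass]
  exact Nat.eq_of_mul_eq_mul_left Nat.card_pos hmul

variable {F G} in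
theorem HasFakeDegrees.card_abelianization_normalizedUnits [Finite F] [Finite G]
    (h : HasFakeDegrees F (augmentationIdeal F G))
    (hnil : IsNilpotentAlgebra (augmentationIdeal F G)) :
    Nat.card (Abelianization (NormalizedUnits F G)) = Nat.card F ^ (classNumber G - 1) := by
  rw [h.card_abelianization hnil, card_cocenter_augmentationIdeal]

end AugmentationIdeal

section Units

theorem card_abelianization_prod (G H : Type*) [Group G] [Group H] :
    Nat.card (Abelianization (G × H)) =
      Nat.card (Abelianization G) * Nat.card (Abelianization H) := by
  have hcomm : commutator (G × H) = (commutator G).prod (commutator H) := by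
    rw [commutator_def, commutator_def, commutator_def, ← Subgroup.commutator_prod_prod,
      Subgroup.top_prod_top]
  simp only [Abelianization, ← Subgroup.index_eq_card]
  rw [hcomm, Subgroup.index_prod]

theorem card_abelianization_of_central_section {G C : Type*} [Group G] [CommGroup C] (r : G →* C)
    (s : C →* G) (hrs : ∀ c, r (s c) = c) (hs : ∀ c g, Commute (s c) g) :
    Nat.card (Abelianization G) = Nat.card C * Nat.card (Abelianization r.ker) := by
  have hcomm (c : C) (g : r.ker) : Commute (s c) (r.ker.subtype g) := hs c g
  have hbij : Function.Bijective (s.noncommCoprod r.ker.subtype hcomm) := by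
    refine ⟨(injective_iff_map_eq_one _).2 fun x hx => ?_, fun g => ?_⟩
    · have hfst : x.1 = 1 := by simpa [hrs, MonoidHom.mem_ker.1 x.2.2] using congrArg r hx
      exact Prod.ext hfst (Subtype.ext (by simpa [hfst] using hx))
    · exact ⟨(r g, ⟨(s (r g))⁻¹ * g, by simp [hrs]⟩), by simp⟩
  rw [← Nat.card_congr (MulEquiv.ofBijective _ hbij).abelianizationCongr.toEquiv,
    card_abelianization_prod, Nat.card_congr (Abelianization.equivOfComm (H := C)).symm.toEquiv]

theorem card_abelianization_units_unitization (F J : Type*) [Field F] [NonUnitalRing J]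
    [Module F J] [IsScalarTower F J J] [SMulCommClass F J J] :
    Nat.card (Abelianization (Unitization F J)ˣ) =
      Nat.card Fˣ * Nat.card (Abelianization (AlgebraGroup F J)) := by
  let r : (Unitization F J)ˣ →* Fˣ :=
    Units.map (Unitization.fstHom F J : Unitization F J →* F)
  have hker : Unitization.unitsFstOne F J = r.ker := by
    ext u
    rw [Unitization.mem_unitsFstOne, MonoidHom.mem_ker, Units.ext_iff]
    rfl
  change _ = _ * Nat.card (Abelianization (Unitization.unitsFstOne F J))
  rw [hker]
  refine card_abelianization_of_central_section r
    (Units.map (algebraMap F (Unitization F J) : F →* _)) (fun c => Units.ext ?_)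
    fun c u => Units.ext (Algebra.commutes _ _)
  exact (Unitization.fstHom F J).commutes c

theorem card_abelianization_units_monoidAlgebra (F G : Type*) [Field F] [Group G] :
    Nat.card (Abelianization (MonoidAlgebra F G)ˣ) =
      Nat.card Fˣ * Nat.card (Abelianization (NormalizedUnits F G)) := by
  rw [← card_abelianization_units_unitization]
  exact Nat.card_congr
    (Units.mapEquiv (unitizationEquiv F G).toMulEquiv).abelianizationCongr.symm.toEquiv

end Units

section CongruenceUnits

variable {R S A : Type*} [Ring R] [Ring S] [CommGroup A] {t : R}

/-- The congruence subgroup of all units of `R` that are `1` modulo `t ^ i`, for central `t`. -/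
def congruenceUnits (ht : ∀ a, Commute t a) (i : ℕ) : Subgroup Rˣ where
  carrier := {u | t ^ i ∣ u.val - 1}
  one_mem' := by simp
  mul_mem' {u v} hu hv := by
    have hmul : (u * v).val - 1 = u * (v.val - 1) + (u.val - 1) := by
      rw [Units.val_mul, mul_sub_one, sub_add_sub_cancel]
    obtain ⟨c, hc⟩ := hv
    rw [Set.mem_ofPred_eq, hmul, hc, ← mul_assoc, ← ((ht _).pow_left i).eq, mul_assoc]
    exact dvd_add (dvd_mul_right _ _) hu
  inv_mem' {u} hu := by
    have hinv : (u⁻¹).val - 1 = (u.val - 1) * -(u⁻¹).val := by simp [sub_mul]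
    rw [Set.mem_ofPred_eq, hinv]
    exact hu.mul_right _

theorem mem_congruenceUnits {ht : ∀ a, Commute t a} {i : ℕ} {u : Rˣ} :
    u ∈ congruenceUnits ht i ↔ t ^ i ∣ u.val - 1 := Iff.rfl

theorem congruenceUnits_anti (ht : ∀ a, Commute t a) : Antitone (congruenceUnits ht) :=
  fun _ _ hij _ hu => (pow_dvd_pow t hij).trans hu

theorem congruenceUnits_eq_bot (ht : ∀ a, Commute t a) {i : ℕ} (hti : t ^ i = 0) :
    congruenceUnits ht i = ⊥ := by
  ext u
  rw [mem_congruenceUnits, hti, zero_dvd_iff, sub_eq_zero, Units.val_eq_one, Subgroup.mem_bot]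

theorem map_eq_map_of_pow_dvd_sub {ht : ∀ a, Commute t a} {i : ℕ} {φ : Rˣ →* A}
    (hφ : congruenceUnits ht i ≤ φ.ker) {u v : Rˣ} (huv : t ^ i ∣ u.val - v.val) :
    φ u = φ v := by
  rw [← mul_inv_eq_one, ← map_inv, ← map_mul, ← MonoidHom.mem_ker]
  refine hφ ?_
  have hsub : (u * v⁻¹).val - 1 = (u.val - v.val) * (v⁻¹).val := by simp [sub_mul]
  rw [mem_congruenceUnits, hsub]
  exact huv.mul_right _

section PrincipalUnits

variable (ht : ∀ a, Commute t a) (htn : IsNilpotent t)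

/-- The unit `1 + t ^ (i + 1) * a`, for central nilpotent `t`. -/
def principalUnit (i : ℕ) (a : R) : Rˣ :=
  (((ht a).pow_left (i + 1)).isNilpotent_mul_right
    (htn.pow_of_pos i.succ_ne_zero)).isUnit_one_add.unit

theorem val_principalUnit (i : ℕ) (a : R) :
    (principalUnit ht htn i a).val = 1 + t ^ (i + 1) * a := rfl

/-- The map `a ↦ φ (1 + t ^ (i + 1) * a)`, which is additive because these units multiply as the
elements `a` add up modulo `t ^ (i + 2)`. -/
def principalUnitHom (i : ℕ) (φ : Rˣ →* A) (hφ : congruenceUnits ht (i + 2) ≤ φ.ker) :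
    R →+ Additive A where
  toFun a := Additive.ofMul (φ (principalUnit ht htn i a))
  map_zero' := by
    have hone : principalUnit ht htn i 0 = 1 := Units.ext (by simp [val_principalUnit])
    rw [hone, map_one, ofMul_one]
  map_add' a b := by
    rw [← ofMul_mul, ← map_mul]
    refine congrArg Additive.ofMul (map_eq_map_of_pow_dvd_sub hφ (dvd_sub_comm.1 ?_))
    have hmul : (principalUnit ht htn i a * principalUnit ht htn i b).val -
        (principalUnit ht htn i (a + b)).val = t ^ (i + 2) * (t ^ i * (a * b)) := by
      simp only [Units.val_mul, val_principalUnit, mul_add, add_mul, one_mul, mul_one]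
      rw [mul_assoc, ← mul_assoc a, ← ((ht a).pow_left (i + 1)).eq, ← mul_assoc, ← mul_assoc,
        ← pow_add, ← mul_assoc, ← pow_add, mul_assoc, show i + 1 + (i + 1) = i + 2 + i by ring]
      abel
    exact ⟨_, hmul⟩

variable {i : ℕ} {φ : Rˣ →* A} (hφ : congruenceUnits ht (i + 2) ≤ φ.ker)

theorem principalUnitHom_eq_zero_of_dvd {a : R} (ha : t ∣ a) :
    principalUnitHom ht htn i φ hφ a = 0 := by
  obtain ⟨b, rfl⟩ := ha
  refine congrArg Additive.ofMul (MonoidHom.mem_ker.1 (hφ (mem_congruenceUnits.2 ?_)))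
  rw [val_principalUnit, add_sub_cancel_left, ← mul_assoc, ← pow_succ]
  exact dvd_mul_right _ _

theorem principalUnitHom_unit_mul (u : Rˣ) (b : R) :
    principalUnitHom ht htn i φ hφ (u * b) = principalUnitHom ht htn i φ hφ (b * u) := by
  have hconj : principalUnit ht htn i (u * b) = u * principalUnit ht htn i (b * u) * u⁻¹ := by
    refine Units.ext ?_
    simp only [Units.val_mul, val_principalUnit, mul_add, add_mul, mul_one, Units.mul_inv]
    rw [← mul_assoc, ← mul_assoc, ← ((ht u).pow_left (i + 1)).eq, mul_assoc, mul_assoc, mul_assoc,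
      mul_assoc, Units.mul_inv, mul_one]
  refine congrArg Additive.ofMul ?_
  rw [hconj, map_mul, map_mul, mul_right_comm, ← map_mul, mul_inv_cancel, map_one, one_mul]

theorem principalUnitHom_mul_comm
    (hgen : AddSubgroup.closure (Set.range (Units.val : Rˣ → R)) = ⊤) (a b : R) :
    principalUnitHom ht htn i φ hφ (a * b) = principalUnitHom ht htn i φ hφ (b * a) := by
  induction hgen ▸ AddSubgroup.mem_top a using AddSubgroup.closure_induction with
  | mem a ha =>
    obtain ⟨u, rfl⟩ := ha
    exact principalUnitHom_unit_mul ht htn hφ u b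
  | zero => simp
  | add x y _ _ hx hy => rw [add_mul, mul_add, map_add, map_add, hx, hy]
  | neg x _ hx => rw [neg_mul, mul_neg, map_neg, map_neg, hx]

theorem range_principalUnitHom :
    Set.range (fun a => (principalUnitHom ht htn i φ hφ a).toMul) =
      (congruenceUnits ht (i + 1)).map φ := by
  refine subset_antisymm ?_ ?_
  · rintro _ ⟨a, rfl⟩
    exact ⟨_, ⟨a, add_sub_cancel_left _ _⟩, rfl⟩
  · rintro _ ⟨u, ⟨a, ha⟩, rfl⟩
    have hu : principalUnit ht htn i a = u :=
      Units.ext (by rw [val_principalUnit, ← ha, add_sub_cancel])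
    exact ⟨a, congrArg φ hu⟩

end PrincipalUnits

theorem addOrderOf_mul_card_range_le {B C : Type*} [AddGroup B] [AddGroup C] [Finite B]
    (f : B →+ C) {b : B} (hb : f b = 0) : addOrderOf b * Nat.card f.range ≤ Nat.card B := by
  have hker : addOrderOf b ≤ Nat.card f.ker := by
    rw [← Nat.card_zmultiples]
    exact Nat.card_mono (Set.toFinite _) (AddSubgroup.zmultiples_le_of_mem hb)
  rw [← AddSubgroup.card_mul_index f.ker, AddSubgroup.index_ker]
  exact Nat.mul_le_mul_right _ hker

variable {f : R →+* S}

theorem addOrderOf_mul_card_map_congruenceUnits_le_of_le_ker [Finite (Cocenter S)]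
    (hf : Function.Surjective f) (hker : ∀ a, f a = 0 → t ∣ a) (ht : ∀ a, Commute t a)
    (htn : IsNilpotent t) (hgen : AddSubgroup.closure (Set.range (Units.val : Rˣ → R)) = ⊤)
    {i : ℕ} {φ : Rˣ →* A} (hφ : congruenceUnits ht (i + 2) ≤ φ.ker) {r : R}
    (hr : φ (principalUnit ht htn i r) = 1) :
    addOrderOf (f r : Cocenter S) * Nat.card ((congruenceUnits ht (i + 1)).map φ) ≤
      Nat.card (Cocenter S) := by
  let Φ := principalUnitHom ht htn i φ hφ
  let π : R →+ Cocenter S := (QuotientAddGroup.mk' (ringCommutator S)).comp (f : R →+ S)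
  have hπ : Function.Surjective π := (QuotientAddGroup.mk'_surjective _).comp hf
  have hπΦ : π.ker ≤ Φ.ker := by
    intro a ha
    have hcomm : f a ∈ (ringCommutator R).map (f : R →+ S) :=
      map_ringCommutator_of_surjective (f := (f : R →ₙ+* S)) hf ▸
        (QuotientAddGroup.eq_zero_iff _).1 ha
    obtain ⟨b, hb, hab⟩ := hcomm
    have hsub : Φ (a - b) = 0 := principalUnitHom_eq_zero_of_dvd ht htn hφ
      (hker _ (by rw [map_sub, ← hab]; exact sub_self _))
    have hb0 : Φ b = 0 :=
      ringCommutator_le_ker_iff.2 (principalUnitHom_mul_comm ht htn hφ hgen) hb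
    rwa [map_sub, hb0, sub_zero] at hsub
  let Ψ : Cocenter S →+ Additive A := π.liftOfSurjective hπ ⟨Φ, hπΦ⟩
  have hΨ (a : R) : Ψ (f a) = Φ a := π.liftOfRightInverse_comp_apply _ _ ⟨Φ, hπΦ⟩ a
  have hrange : Nat.card ((congruenceUnits ht (i + 1)).map φ) = Nat.card Ψ.range := by
    have hset : (Ψ.range : Set (Additive A)) = Set.range Φ := by
      rw [AddMonoidHom.coe_range, ← hπ.range_comp]
      exact congrArg Set.range (funext hΨ)
    exact congrArg (fun s : Set A => Nat.card s)
      ((range_principalUnitHom ht htn hφ).symm.trans hset.symm)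
  rw [hrange]
  exact addOrderOf_mul_card_range_le Ψ ((hΨ r).trans (congrArg Additive.ofMul hr))

theorem addOrderOf_mul_card_map_congruenceUnits_le [Finite (Cocenter S)]
    (hf : Function.Surjective f) (hker : ∀ a, f a = 0 → t ∣ a) (ht : ∀ a, Commute t a)
    (htn : IsNilpotent t) (hgen : AddSubgroup.closure (Set.range (Units.val : Rˣ → R)) = ⊤)
    {i : ℕ} {φ : Rˣ →* A} {r : R} (hr : φ (principalUnit ht htn i r) = 1) :
    addOrderOf (f r : Cocenter S) * Nat.card ((congruenceUnits ht (i + 1)).map φ) ≤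
      Nat.card (Cocenter S) * Nat.card ((congruenceUnits ht (i + 2)).map φ) := by
  let B := (congruenceUnits ht (i + 2)).map φ
  have hB : B ≤ (congruenceUnits ht (i + 1)).map φ :=
    Subgroup.map_mono (congruenceUnits_anti ht (Nat.le_succ _))
  have hφB : congruenceUnits ht (i + 2) ≤ ((QuotientGroup.mk' B).comp φ).ker := fun u hu =>
    (QuotientGroup.eq_one_iff _).2 (Subgroup.mem_map_of_mem φ hu)
  have hle := addOrderOf_mul_card_map_congruenceUnits_le_of_le_ker hf hker ht htn hgen hφB (r := r)
    (by rw [MonoidHom.comp_apply, hr, map_one])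
  rw [← Subgroup.map_map, ← Subgroup.relIndex_ker, QuotientGroup.ker_mk'] at hle
  rw [← Subgroup.relIndex_bot_left, ← Subgroup.relIndex_bot_left,
    ← Subgroup.relIndex_mul_relIndex ⊥ B _ bot_le hB, mul_left_comm, mul_comm]
  exact Nat.mul_le_mul_right _ hle

theorem card_map_congruenceUnits_one_le [Finite (Cocenter S)]
    (hf : Function.Surjective f) (hker : ∀ a, f a = 0 → t ∣ a) (ht : ∀ a, Commute t a)
    (htn : IsNilpotent t) (hgen : AddSubgroup.closure (Set.range (Units.val : Rˣ → R)) = ⊤)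
    {φ : Rˣ →* A} {r : R} (hr : φ (principalUnit ht htn 0 r) = 1) (n : ℕ) :
    addOrderOf (f r : Cocenter S) * Nat.card ((congruenceUnits ht 1).map φ) ≤
      Nat.card (Cocenter S) ^ (n + 1) * Nat.card ((congruenceUnits ht (n + 2)).map φ) := by
  induction n with
  | zero =>
    simpa using addOrderOf_mul_card_map_congruenceUnits_le hf hker ht htn hgen hr
  | succ n ih =>
    have hzero : φ (principalUnit ht htn (n + 1) 0) = 1 := by
      rw [show principalUnit ht htn (n + 1) 0 = 1 from Units.ext (by simp [val_principalUnit]),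
        map_one]
    have hstep := addOrderOf_mul_card_map_congruenceUnits_le hf hker ht htn hgen hzero
    rw [map_zero, QuotientAddGroup.mk_zero, addOrderOf_zero, one_mul] at hstep
    rw [pow_succ, mul_assoc]
    exact ih.trans (Nat.mul_le_mul_left _ hstep)

theorem isLocalHom_of_forall_dvd (hf : Function.Surjective f) (hker : ∀ a, f a = 0 → t ∣ a)
    (ht : ∀ a, Commute t a) (htn : IsNilpotent t) : IsLocalHom f := by
  have hone {a : R} (ha : f a = 1) : IsUnit a := by
    obtain ⟨c, hc⟩ := hker (a - 1) (by rw [map_sub, ha, map_one, sub_self])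
    rw [← add_sub_cancel 1 a, hc]
    exact ((ht c).isNilpotent_mul_right htn).isUnit_one_add
  refine ⟨fun a ha => ?_⟩
  obtain ⟨s, has, hsa⟩ := isUnit_iff_exists.1 ha
  obtain ⟨b, rfl⟩ := hf s
  obtain ⟨c, hc⟩ := (hone ((map_mul f a b).trans has)).exists_right_inv
  obtain ⟨d, hd⟩ := (hone ((map_mul f b a).trans hsa)).exists_left_inv
  exact isUnit_iff_exists_and_exists.2
    ⟨⟨b * c, by rw [← mul_assoc, hc]⟩, ⟨d * b, by rw [mul_assoc, hd]⟩⟩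

theorem card_le_card_abelianization_units [Finite (Abelianization Sˣ)]
    (hf : Function.Surjective f) (hker : ∀ a, f a = 0 → t ∣ a) (ht : ∀ a, Commute t a)
    (htn : IsNilpotent t) {φ : Rˣ →* A} (hφ : Function.Surjective φ)
    (hφ1 : congruenceUnits ht 1 ≤ φ.ker) : Nat.card A ≤ Nat.card (Abelianization Sˣ) := by
  have := isLocalHom_of_forall_dvd hf hker ht htn
  have hunits : Function.Surjective (Units.map (f : R →* S)) :=
    IsLocalRing.surjective_units_map_of_local_ringHom f hf this
  have hle : (Units.map (f : R →* S)).ker ≤ φ.ker := fun u hu => hφ1 <| by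
    rw [mem_congruenceUnits, pow_one]
    refine hker _ ?_
    rw [map_sub, map_one, sub_eq_zero]
    exact congrArg Units.val hu
  let ψ : Sˣ →* A := (Units.map (f : R →* S)).liftOfSurjective hunits ⟨φ, hle⟩
  have hψ (u : Rˣ) : ψ (Units.map f u) = φ u :=
    (Units.map (f : R →* S)).liftOfRightInverse_comp_apply _ _ ⟨φ, hle⟩ u
  refine Nat.card_le_card_of_surjective (Abelianization.lift ψ) fun a => ?_
  obtain ⟨u, rfl⟩ := hφ a
  exact ⟨Abelianization.of (Units.map f u), (Abelianization.lift_apply_of ψ _).trans (hψ u)⟩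

theorem addOrderOf_one_mul_card_abelianization_units_le [Finite S]
    (hf : Function.Surjective f) (hker : ∀ a, f a = 0 → t ∣ a) (ht : ∀ a, Commute t a) {n : ℕ}
    (htn : t ^ (n + 2) = 0) (hgen : AddSubgroup.closure (Set.range (Units.val : Rˣ → R)) = ⊤)
    {u : Rˣ} (hu : u.val = 1 + t) (huc : u ∈ commutator Rˣ) :
    addOrderOf ((1 : S) : Cocenter S) * Nat.card (Abelianization Rˣ) ≤
      Nat.card (Abelianization Sˣ) * Nat.card (Cocenter S) ^ (n + 1) := by
  have hnil : IsNilpotent t := ⟨_, htn⟩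
  let φ : Rˣ →* Abelianization Rˣ := Abelianization.of
  let B := (congruenceUnits ht 1).map φ
  have hφu : φ (principalUnit ht hnil 0 1) = 1 := by
    rw [show principalUnit ht hnil 0 1 = u from
      Units.ext (by rw [val_principalUnit, hu, zero_add, pow_one, mul_one])]
    exact (QuotientGroup.eq_one_iff u).2 huc
  have hB : addOrderOf ((1 : S) : Cocenter S) * Nat.card B ≤ Nat.card (Cocenter S) ^ (n + 1) := by
    have hle := card_map_congruenceUnits_one_le hf hker ht hnil hgen hφu n
    rwa [congruenceUnits_eq_bot ht htn, Subgroup.map_bot, Subgroup.card_bot, mul_one,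
      map_one] at hle
  have hindex : B.index ≤ Nat.card (Abelianization Sˣ) :=
    card_le_card_abelianization_units hf hker ht hnil (φ := (QuotientGroup.mk' B).comp φ)
      ((QuotientGroup.mk'_surjective B).comp (QuotientGroup.mk'_surjective _))
      fun v hv => (QuotientGroup.eq_one_iff _).2 (Subgroup.mem_map_of_mem φ hv)
  rw [← B.card_mul_index, ← mul_assoc, mul_comm]
  exact Nat.mul_le_mul hindex hB

end CongruenceUnits

section GroupAlgebra

variable {F G Q : Type*} [Group G] [Group Q] {p : ℕ} {z : G}

theorem closure_units_monoidAlgebra (F G : Type*) [Field F] [Group G] :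
    AddSubgroup.closure (Set.range (Units.val : (MonoidAlgebra F G)ˣ → MonoidAlgebra F G)) = ⊤ := by
  refine (AddSubgroup.eq_top_iff' _).2 fun x => ?_
  induction x using MonoidAlgebra.induction_linear with
  | zero => exact zero_mem _
  | add x y hx hy => exact add_mem hx hy
  | single g r =>
    rcases eq_or_ne r 0 with rfl | hr
    · rw [MonoidAlgebra.single_zero]
      exact zero_mem _
    · refine AddSubgroup.subset_closure
        ⟨⟨.single g r, .single g⁻¹ r⁻¹, ?_, ?_⟩, rfl⟩ <;>
      simp [MonoidAlgebra.single_mul_single, hr, MonoidAlgebra.one_def]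

section CommRing

variable [CommRing F]

theorem commute_of_sub_one (hz : z ∈ Subgroup.center G) (a : MonoidAlgebra F G) :
    Commute (MonoidAlgebra.of F G z - 1) a :=
  (MonoidAlgebra.of_commute (fun g => (Subgroup.mem_center_iff.1 hz g).symm) a).sub_left
    (Commute.one_left a)

theorem charP_monoidAlgebra (F G : Type*) [CommRing F] [CharP F p] [Group G] :
    CharP (MonoidAlgebra F G) p :=
  charP_of_injective_algebraMap (FaithfulSMul.algebraMap_injective F (MonoidAlgebra F G)) p

theorem of_sub_one_pow_eq_zero [Fact p.Prime] [CharP F p] (hzp : z ^ p = 1) :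
    (MonoidAlgebra.of F G z - 1) ^ p = 0 := by
  have := charP_monoidAlgebra (p := p) F G
  rw [sub_pow_char_of_commute p (Commute.one_right _), ← map_pow, hzp, map_one, one_pow, sub_self]

theorem of_sub_one_dvd_of_mem_powers {g : G} (hg : g ∈ Submonoid.powers z) :
    MonoidAlgebra.of F G z - 1 ∣ MonoidAlgebra.of F G g - 1 := by
  obtain ⟨n, rfl⟩ := hg
  simpa only [map_pow, one_pow] using
    (Commute.one_right (MonoidAlgebra.of F G z)).sub_dvd_pow_sub_pow n

theorem of_sub_one_dvd_of_mapDomain_eq_zero (hz : z ∈ Subgroup.center G) {f : G →* Q}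
    (hf : Function.Surjective f) (hker : ∀ g, f g = 1 → g ∈ Submonoid.powers z)
    {a : MonoidAlgebra F G} (ha : MonoidAlgebra.mapDomain f a = 0) :
    MonoidAlgebra.of F G z - 1 ∣ a := by
  have hmem : a ∈ (AddMonoidHom.mulLeft (MonoidAlgebra.of F G z - 1)).range := by
    refine mem_of_mapDomain_eq_zero hf (fun g h r hgh => ?_) ha
    obtain ⟨c, hc⟩ := of_sub_one_dvd_of_mem_powers (F := F)
      (hker (h⁻¹ * g) (by rw [map_mul, map_inv, hgh, inv_mul_cancel]))
    have hsub : MonoidAlgebra.single g r - MonoidAlgebra.single h r =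
        MonoidAlgebra.single h r * (MonoidAlgebra.of F G (h⁻¹ * g) - 1) := by
      simp [mul_sub, MonoidAlgebra.single_mul_single]
    refine ⟨MonoidAlgebra.single h r * c, ?_⟩
    rw [hsub, hc, AddMonoidHom.coe_mulLeft, ← mul_assoc, (commute_of_sub_one hz _).eq, mul_assoc]
  obtain ⟨c, rfl⟩ := hmem
  exact dvd_mul_right _ _

end CommRing

theorem addOrderOf_one_cocenter_monoidAlgebra (F G : Type*) [Field F] [Fact p.Prime] [CharP F p]
    [Group G] : addOrderOf ((1 : MonoidAlgebra F G) : Cocenter (MonoidAlgebra F G)) = p := by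
  have := charP_monoidAlgebra (p := p) F G
  refine addOrderOf_eq_prime ?_ fun h => one_notMem_ringCommutator
    (augmentation F G : MonoidAlgebra F G →+* F) ((QuotientAddGroup.eq_zero_iff _).1 h)
  rw [← QuotientAddGroup.mk_nsmul, nsmul_one, CharP.cast_eq_zero, QuotientAddGroup.mk_zero]

theorem toHomUnits_mem_commutator {M : Type*} [Monoid M] (φ : G →* M) (hz : z ∈ commutator G) :
    φ.toHomUnits z ∈ commutator Mˣ := by
  have hmap : (commutator G).map φ.toHomUnits ≤ commutator Mˣ := by
    rw [commutator_def, commutator_def, Subgroup.map_commutator]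
    exact Subgroup.commutator_mono le_top le_top
  exact hmap (Subgroup.mem_map_of_mem _ hz)

theorem card_abelianization_normalizedUnits_mul_le [Field F] [Finite F] [Fact p.Prime] [CharP F p]
    [Finite Q]
    (hz : z ∈ Subgroup.center G) (hzp : z ^ p = 1) (hzc : z ∈ commutator G) {f : G →* Q}
    (hf : Function.Surjective f) (hker : ∀ g, f g = 1 → g ∈ Submonoid.powers z) :
    p * Nat.card (Abelianization (NormalizedUnits F G)) ≤
      Nat.card (Abelianization (NormalizedUnits F Q)) *
        (Nat.card F ^ classNumber Q) ^ (p - 1) := by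
  have hp : p - 2 + 2 = p := Nat.sub_add_cancel (Fact.out : p.Prime).two_le
  have hle := addOrderOf_one_mul_card_abelianization_units_le (n := p - 2)
    (f := MonoidAlgebra.mapDomainRingHom F f) (mapDomain_surjective hf)
    (fun a ha => of_sub_one_dvd_of_mapDomain_eq_zero hz hf hker ha) (commute_of_sub_one hz)
    (by rw [hp, of_sub_one_pow_eq_zero hzp]) (closure_units_monoidAlgebra F G)
    (u := (MonoidAlgebra.of F G).toHomUnits z) (add_sub_cancel _ _).symm
    (toHomUnits_mem_commutator _ hzc)
  rw [addOrderOf_one_cocenter_monoidAlgebra (p := p), card_cocenter_monoidAlgebra,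
    card_abelianization_units_monoidAlgebra, card_abelianization_units_monoidAlgebra,
    mul_left_comm, mul_assoc] at hle
  rw [show p - 1 = p - 2 + 1 by omega]
  exact Nat.le_of_mul_le_mul_left hle Nat.card_pos

end GroupAlgebra

section ClassNumber

theorem classNumber_eq_card_ker_mul {G Q : Type*} [Group G] [Group Q] {f : G →* Q}
    (hf : Function.Surjective f) (hcenter : f.ker ≤ Subgroup.center G)
    (hcomm : ∀ g h : G, ⁅g, h⁆ ∈ f.ker → ⁅g, h⁆ = 1) :
    classNumber G = Nat.card f.ker * classNumber Q := by
  choose rep hrep using ConjClasses.mk_surjective.comp hf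
  let Φ : f.ker × ConjClasses Q → ConjClasses G := fun x => ConjClasses.mk (x.1 * rep x.2)
  suffices hΦ : Function.Bijective Φ by
    rw [classNumber, classNumber, ← Nat.card_prod, Nat.card_eq_of_bijective Φ hΦ]
  constructor
  · rintro ⟨ζ, c⟩ ⟨ξ, d⟩ hx
    have hconj : IsConj (ζ * rep c) (ξ * rep d) := ConjClasses.mk_eq_mk_iff_isConj.1 hx
    obtain rfl : c = d := by
      rw [← hrep c, ← hrep d]
      refine ConjClasses.mk_eq_mk_iff_isConj.2 ?_
      simpa [MonoidHom.mem_ker.1 ζ.2, MonoidHom.mem_ker.1 ξ.2] using f.map_isConj hconj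
    obtain ⟨g, hg⟩ := isConj_iff.1 hconj
    have hmul : (ζ : G) * ⁅g, rep c⁆ = ξ :=
      calc (ζ : G) * ⁅g, rep c⁆ = g * (ζ * rep c) * g⁻¹ * (rep c)⁻¹ := by
            rw [← mul_assoc g, Subgroup.mem_center_iff.1 (hcenter ζ.2) g]
            group
        _ = ξ := by rw [hg, mul_inv_cancel_right]
    have hone : ⁅g, rep c⁆ = 1 :=
      hcomm _ _ (eq_inv_mul_of_mul_eq hmul ▸ mul_mem (inv_mem ζ.2) ξ.2)
    rw [hone, mul_one] at hmul
    rw [Subtype.ext hmul]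
  · refine ConjClasses.mk_surjective.forall.2 fun g => ?_
    obtain ⟨q, hq⟩ := isConj_iff.1 (ConjClasses.mk_eq_mk_iff_isConj.1 (hrep (.mk (f g))))
    obtain ⟨k, rfl⟩ := hf q
    have hker : g * (k * rep (.mk (f g)) * k⁻¹)⁻¹ ∈ f.ker := by
      rw [MonoidHom.mem_ker, map_mul, map_inv, map_mul, map_mul, map_inv, hq, mul_inv_cancel]
    refine ⟨(⟨_, hker⟩, .mk (f g)), ConjClasses.mk_eq_mk_iff_isConj.2 (isConj_iff.2 ⟨k, ?_⟩)⟩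
    rw [← mul_assoc, Subgroup.mem_center_iff.1 (hcenter hker) k]
    group

end ClassNumber

section ClassTwo

variable {G : Type*} [Group G] {S T : Set G} {n : ℕ}

theorem closure_le_center (hS : Subgroup.closure S = ⊤) (hT : ∀ t ∈ T, ∀ s ∈ S, Commute t s) :
    Subgroup.closure T ≤ Subgroup.center G := by
  rw [Subgroup.closure_le, ← Subgroup.centralizer_univ, ← Subgroup.coe_top, ← hS,
    Subgroup.centralizer_closure]
  exact fun t ht s hs => (hT t ht s hs).eq.symm

theorem normal_of_le_center {H : Subgroup G} (hH : H ≤ Subgroup.center G) : H.Normal :=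
  ⟨fun h hh g => by rwa [Subgroup.mem_center_iff.1 (hH hh) g, mul_inv_cancel_right]⟩

theorem pow_eq_one_of_mem_closure (hT : Subgroup.closure T ≤ Subgroup.center G)
    (hn : ∀ t ∈ T, t ^ n = 1) {g : G} (hg : g ∈ Subgroup.closure T) : g ^ n = 1 := by
  induction hg using Subgroup.closure_induction with
  | mem t ht => exact hn t ht
  | one => exact one_pow n
  | mul x y _ hy hxn hyn =>
    have hxy : Commute x y := Subgroup.mem_center_iff.1 (hT hy) x
    rw [hxy.mul_pow, hxn, hyn, one_mul]
  | inv x _ hx => rw [inv_pow, hx, inv_one]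

theorem finite_closure_of_le_center (hT : Subgroup.closure T ≤ Subgroup.center G)
    (hfin : T.Finite) (hn0 : 0 < n) (hn : ∀ t ∈ T, t ^ n = 1) : Finite (Subgroup.closure T) := by
  let _ : CommGroup (Subgroup.closure T) :=
    { mul_comm := fun a b => Subtype.ext (Subgroup.mem_center_iff.1 (hT b.2) a) }
  have : Finite T := hfin
  refine CommGroup.finite_of_fg_isMulTorsion _ fun g => isOfFinOrder_iff_pow_eq_one.2 ⟨n, hn0, ?_⟩
  exact Subtype.ext (pow_eq_one_of_mem_closure hT hn g.2)

theorem commutatorElement_pow_eq_one {x y : G} (hxy : Commute ⁅x, y⁆ y) (hy : y ^ n = 1) :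
    ⁅x, y⁆ ^ n = 1 := by
  have hconj : (⁅x, y⁆ * y) ^ n = 1 := by
    rw [commutatorElement_def, inv_mul_cancel_right, conj_pow, hy, mul_one, mul_inv_cancel]
  rwa [hxy.mul_pow, hy, mul_one] at hconj

theorem closure_commutators_le_center (hS : Subgroup.closure S = ⊤)
    (hc : ∀ x ∈ S, ∀ y ∈ S, ∀ s ∈ S, Commute ⁅x, y⁆ s) :
    Subgroup.closure (Set.image2 (⁅·, ·⁆) S S) ≤ Subgroup.center G :=
  closure_le_center hS (Set.forall_mem_image2.2 hc)

theorem closure_image_mk_eq_top (hS : Subgroup.closure S = ⊤) (N : Subgroup G) [N.Normal] :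
    Subgroup.closure (QuotientGroup.mk' N '' S) = ⊤ := by
  rw [← MonoidHom.map_closure, hS, ← MonoidHom.range_eq_map, QuotientGroup.range_mk']

theorem closure_image_mk_le_center (hS : Subgroup.closure S = ⊤) {N : Subgroup G} [N.Normal]
    (hN : Set.image2 (⁅·, ·⁆) S S ⊆ N) :
    Subgroup.closure (QuotientGroup.mk' N '' S) ≤ Subgroup.center (G ⧸ N) := by
  refine closure_le_center (closure_image_mk_eq_top hS N) ?_
  rintro _ ⟨x, hx, rfl⟩ _ ⟨y, hy, rfl⟩
  rw [← commutatorElement_eq_one_iff_commute, ← map_commutatorElement]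
  exact (QuotientGroup.eq_one_iff _).2 (hN (Set.mem_image2_of_mem hx hy))

theorem finite_of_commutators_central (hS : Subgroup.closure S = ⊤) (hfin : S.Finite)
    (hc : ∀ x ∈ S, ∀ y ∈ S, ∀ s ∈ S, Commute ⁅x, y⁆ s) (hn0 : 0 < n) (hn : ∀ s ∈ S, s ^ n = 1) :
    Finite G := by
  have hcenter := closure_commutators_le_center hS hc
  let C := Subgroup.closure (Set.image2 (⁅·, ·⁆) S S)
  have : C.Normal := normal_of_le_center hcenter
  have : Finite C := finite_closure_of_le_center hcenter (hfin.image2 _ hfin) hn0 <|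
    Set.forall_mem_image2.2 fun x hx y hy =>
      commutatorElement_pow_eq_one (hc x hx y hy y hy) (hn y hy)
  have hquot : Finite (Subgroup.closure (QuotientGroup.mk' C '' S)) :=
    finite_closure_of_le_center (closure_image_mk_le_center hS Subgroup.subset_closure)
      (hfin.image _) hn0 <| Set.forall_mem_image.2 fun s hs => by rw [← map_pow, hn s hs, map_one]
  rw [closure_image_mk_eq_top hS C] at hquot
  have : Finite (G ⧸ C) := Finite.of_equiv _ Subgroup.topEquiv.toEquiv
  exact Finite.of_subgroup_quotient C

theorem pow_pow_eq_one_of_commutators_central (hS : Subgroup.closure S = ⊤)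
    (hc : ∀ x ∈ S, ∀ y ∈ S, ∀ s ∈ S, Commute ⁅x, y⁆ s) (hn : ∀ s ∈ S, s ^ n = 1) (g : G) :
    (g ^ n) ^ n = 1 := by
  have hcenter := closure_commutators_le_center hS hc
  let C := Subgroup.closure (Set.image2 (⁅·, ·⁆) S S)
  have : C.Normal := normal_of_le_center hcenter
  have hgC : g ^ n ∈ C := (QuotientGroup.eq_one_iff _).1 <|
    pow_eq_one_of_mem_closure (closure_image_mk_le_center hS Subgroup.subset_closure)
      (Set.forall_mem_image.2 fun s hs => by rw [← map_pow, hn s hs, map_one])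
      (closure_image_mk_eq_top hS C ▸ Subgroup.mem_top (QuotientGroup.mk' C g))
  exact pow_eq_one_of_mem_closure hcenter
    (Set.forall_mem_image2.2 fun x hx y hy =>
      commutatorElement_pow_eq_one (hc x hx y hy y hy) (hn y hy)) hgC

end ClassTwo

section BilinearExtension

/-- The central extension of `V` by `W` whose cocycle is the biadditive map `β`. For
non-symmetric `β` it is a group of nilpotency class two. -/
@[ext]
structure BilinearExtension {V W : Type*} [AddCommGroup V] [AddCommGroup W]
    (β : V →+ V →+ W) where
  fst : V
  snd : W

namespace BilinearExtension

variable {V W : Type*} [AddCommGroup V] [AddCommGroup W] {β : V →+ V →+ W}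

instance : Mul (BilinearExtension β) := ⟨fun a b => ⟨a.fst + b.fst, a.snd + b.snd + β a.fst b.fst⟩⟩
instance : One (BilinearExtension β) := ⟨⟨0, 0⟩⟩
instance : Inv (BilinearExtension β) := ⟨fun a => ⟨-a.fst, -a.snd + β a.fst a.fst⟩⟩

theorem mul_def (a b : BilinearExtension β) :
    a * b = ⟨a.fst + b.fst, a.snd + b.snd + β a.fst b.fst⟩ := rfl

theorem one_def : (1 : BilinearExtension β) = ⟨0, 0⟩ := rfl

theorem inv_def (a : BilinearExtension β) : a⁻¹ = ⟨-a.fst, -a.snd + β a.fst a.fst⟩ := rfl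

instance : Group (BilinearExtension β) :=
  Group.ofLeftAxioms
    (fun a b c => by
      ext
      · simp only [mul_def, add_assoc]
      · simp only [mul_def, map_add, AddMonoidHom.add_apply]
        abel)
    (fun a => by ext <;> simp [mul_def, one_def])
    (fun a => by ext <;> simp [mul_def, one_def, inv_def])

theorem commutatorElement_eq (a b : BilinearExtension β) :
    ⁅a, b⁆ = ⟨0, β a.fst b.fst - β b.fst a.fst⟩ := by
  rw [commutatorElement_def, mul_inv_eq_iff_eq_mul, mul_inv_eq_iff_eq_mul]
  ext
  · simp [mul_def, add_comm]
  · simp only [mul_def, map_zero, AddMonoidHom.zero_apply, zero_add]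
    abel

theorem commutatorElement_commutatorElement (a b c : BilinearExtension β) : ⁅⁅a, b⁆, c⁆ = 1 := by
  simp [commutatorElement_eq, one_def]

theorem pow_eq {a : BilinearExtension β} (ha : β a.fst a.fst = 0) (n : ℕ) :
    a ^ n = ⟨n • a.fst, n • a.snd⟩ := by
  induction n with
  | zero => simp [one_def]
  | succ n ih => simp [pow_succ, ih, mul_def, ha, succ_nsmul]

end BilinearExtension

end BilinearExtension

section Minors

variable {ι R : Type*} [CommRing R]

/-- The `2 × 2` minor in the columns `i` and `j` of the matrix with rows `v` and `w`. -/
def minor (v w : ι → R) (i j : ι) : R := v i * w j - w i * v j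

theorem minor_plucker (v w : ι → R) (i j k l : ι) :
    minor v w i j * minor v w k l - minor v w i k * minor v w j l +
      minor v w i l * minor v w j k = 0 := by
  simp only [minor]
  ring

variable [LinearOrder ι]

/-- The strictly upper triangular part of the tensor product of two vectors. Its antisymmetrization
is the exterior product, so that a minor is the commutator in the associated extension, in
characteristic `2` as well. -/
def strictUpperTensor (ι R : Type*) [CommRing R] [LinearOrder ι] :
    (ι → R) →+ (ι → R) →+ (ι → ι → R) :=
  AddMonoidHom.mk' (fun v => AddMonoidHom.mk' (fun w i j => if i < j then v i * w j else 0)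
    fun w w' => by ext i j; simp [mul_add, ite_add_ite])
    fun v v' => by ext w i j; simp [add_mul, ite_add_ite]

theorem strictUpperTensor_apply (v w : ι → R) (i j : ι) :
    strictUpperTensor ι R v w i j = if i < j then v i * w j else 0 := rfl

theorem strictUpperTensor_single_self (i : ι) (r s : R) :
    strictUpperTensor ι R (Pi.single i r) (Pi.single i s) = 0 := by
  ext j k
  rw [strictUpperTensor_apply, Pi.zero_apply, Pi.zero_apply, ite_eq_right_iff]
  intro hjk
  rcases eq_or_ne j i with rfl | hj
  · rw [Pi.single_eq_of_ne hjk.ne', mul_zero]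
  · rw [Pi.single_eq_of_ne hj, zero_mul]

theorem strictUpperTensor_sub_swap {i j : ι} (hij : i < j) (v w : ι → R) :
    (strictUpperTensor ι R v w - strictUpperTensor ι R w v) i j = minor v w i j := by
  simp only [Pi.sub_apply, strictUpperTensor_apply, if_pos hij, minor]

end Minors

namespace PiGroup

variable (p : ℕ)

/-- The generator `x_{i + 1}` of `π`. -/
abbrev gen (i : Fin 4) : PiGroup p := PresentedGroup.of i

theorem gen_pow (i : Fin 4) : gen p i ^ p = 1 :=
  PresentedGroup.one_of_mem (rels := relators p) (Or.inl ⟨i, rfl⟩)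

theorem commute_commutator_gen (i j k : Fin 4) : Commute ⁅gen p i, gen p j⁆ (gen p k) :=
  commutatorElement_eq_one_iff_commute.1
    (PresentedGroup.one_of_mem (rels := relators p) (Or.inr ⟨i, j, k, rfl⟩))

theorem closure_range_gen : Subgroup.closure (Set.range (gen p)) = ⊤ :=
  PresentedGroup.closure_range_of _

theorem commute_commutator_of_mem_range_gen :
    ∀ x ∈ Set.range (gen p), ∀ y ∈ Set.range (gen p), ∀ s ∈ Set.range (gen p),
      Commute ⁅x, y⁆ s := by
  rintro _ ⟨i, rfl⟩ _ ⟨j, rfl⟩ _ ⟨k, rfl⟩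
  exact commute_commutator_gen p i j k

instance [hp : Fact p.Prime] : Finite (PiGroup p) :=
  finite_of_commutators_central (closure_range_gen p) (Set.finite_range _)
    (commute_commutator_of_mem_range_gen p) hp.out.pos (Set.forall_mem_range.2 (gen_pow p))

theorem isPGroup : IsPGroup p (PiGroup p) :=
  fun g => ⟨2, by
    rw [pow_two, pow_mul]
    exact pow_pow_eq_one_of_commutators_central (closure_range_gen p)
      (commute_commutator_of_mem_range_gen p) (Set.forall_mem_range.2 (gen_pow p)) g⟩

theorem commutator_gen_mem_center (i j : Fin 4) :
    ⁅gen p i, gen p j⁆ ∈ Subgroup.center (PiGroup p) :=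
  closure_commutators_le_center (closure_range_gen p) (commute_commutator_of_mem_range_gen p)
    (Subgroup.subset_closure (Set.mem_image2_of_mem (Set.mem_range_self i) (Set.mem_range_self j)))

theorem commutator_gen_pow (i j : Fin 4) : ⁅gen p i, gen p j⁆ ^ p = 1 :=
  commutatorElement_pow_eq_one (commute_commutator_gen p i j j) (gen_pow p j)

theorem zElement_mem_center : zElement p ∈ Subgroup.center (PiGroup p) :=
  mul_mem (commutator_gen_mem_center p 0 1) (commutator_gen_mem_center p 2 3)

theorem zElement_pow : zElement p ^ p = 1 := by
  have hcomm : Commute ⁅gen p 0, gen p 1⁆ ⁅gen p 2, gen p 3⁆ :=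
    Subgroup.mem_center_iff.1 (commutator_gen_mem_center p 2 3) _
  rw [zElement, hcomm.mul_pow, commutator_gen_pow, commutator_gen_pow, one_mul]

theorem zElement_mem_commutator : zElement p ∈ commutator (PiGroup p) :=
  mul_mem (Subgroup.commutator_mem_commutator (Subgroup.mem_top _) (Subgroup.mem_top _))
    (Subgroup.commutator_mem_commutator (Subgroup.mem_top _) (Subgroup.mem_top _))

/-- The homomorphism from `π` that sends the generators to the standard basis vectors. It detects
the coefficients of a product of powers of the basic commutators `[x_i, x_j]`. -/
def toBilinearExtension : PiGroup p →* BilinearExtension (strictUpperTensor (Fin 4) (ZMod p)) :=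
  PresentedGroup.toGroup (f := fun i => ⟨Pi.single i 1, 0⟩) (by
    rintro r (⟨i, rfl⟩ | ⟨j, k, l, rfl⟩)
    · rw [map_pow, FreeGroup.lift_apply_of,
        BilinearExtension.pow_eq (strictUpperTensor_single_self i 1 1)]
      simp [BilinearExtension.one_def]
    · simp only [map_commutatorElement, BilinearExtension.commutatorElement_commutatorElement])

theorem toBilinearExtension_gen (i : Fin 4) :
    toBilinearExtension p (gen p i) = ⟨Pi.single i 1, 0⟩ :=
  PresentedGroup.toGroup.of _

variable {p}

theorem toBilinearExtension_commutatorElement_snd (g h : PiGroup p) {i j : Fin 4} (hij : i < j) :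
    (toBilinearExtension p ⁅g, h⁆).snd i j =
      minor (toBilinearExtension p g).fst (toBilinearExtension p h).fst i j := by
  rw [map_commutatorElement, BilinearExtension.commutatorElement_eq]
  exact strictUpperTensor_sub_swap hij _ _

theorem toBilinearExtension_zElement_pow_snd (n : ℕ) {i j : Fin 4} (hij : i < j) :
    (toBilinearExtension p (zElement p ^ n)).snd i j =
      n * (minor (Pi.single 0 1) (Pi.single 1 1) i j +
        minor (Pi.single 2 1) (Pi.single 3 1) i j) := by
  rw [map_pow, zElement, map_mul, map_commutatorElement, map_commutatorElement,
    BilinearExtension.commutatorElement_eq, BilinearExtension.commutatorElement_eq,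
    BilinearExtension.mul_def, BilinearExtension.pow_eq (by simp)]
  simp only [toBilinearExtension_gen, map_zero, add_zero, Pi.smul_apply, Pi.add_apply,
    strictUpperTensor_sub_swap hij, nsmul_eq_mul]

theorem dvd_of_commutatorElement_eq_zElement_pow [Fact p.Prime] {g h : PiGroup p} {n : ℕ}
    (hgh : ⁅g, h⁆ = zElement p ^ n) : p ∣ n := by
  let v := (toBilinearExtension p g).fst
  let w := (toBilinearExtension p h).fst
  have hminor {i j : Fin 4} (hij : i < j) : minor v w i j =
      n * (minor (Pi.single 0 1) (Pi.single 1 1) i j +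
        minor (Pi.single 2 1) (Pi.single 3 1) i j) := by
    rw [← toBilinearExtension_commutatorElement_snd g h hij, hgh,
      toBilinearExtension_zElement_pow_snd n hij]
  have h01 : minor v w 0 1 = n := by simpa [minor] using hminor (i := 0) (j := 1) (by decide)
  have h23 : minor v w 2 3 = n := by simpa [minor] using hminor (i := 2) (j := 3) (by decide)
  have h02 : minor v w 0 2 = 0 := by simpa [minor] using hminor (i := 0) (j := 2) (by decide)
  have h03 : minor v w 0 3 = 0 := by simpa [minor] using hminor (i := 0) (j := 3) (by decide)
  have hsq : (n : ZMod p) * n = 0 := by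
    simpa [h01, h23, h02, h03] using minor_plucker v w 0 1 2 3
  exact (CharP.cast_eq_zero_iff (ZMod p) p n).1 (mul_self_eq_zero.1 hsq)

variable (p)

theorem normalClosure_zElement :
    Subgroup.normalClosure {zElement p} = Subgroup.zpowers (zElement p) := by
  have hz : Subgroup.zpowers (zElement p) ≤ Subgroup.center (PiGroup p) :=
    Subgroup.zpowers_le.2 (zElement_mem_center p)
  have := normal_of_le_center hz
  refine le_antisymm (Subgroup.normalClosure_le_normal ?_)
    (Subgroup.zpowers_le.2 (Subgroup.subset_normalClosure rfl))
  exact Set.singleton_subset_iff.2 (Subgroup.mem_zpowers _)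

variable [Fact p.Prime]

theorem orderOf_zElement : orderOf (zElement p) = p := by
  refine orderOf_eq_prime (zElement_pow p) fun h => (Fact.out : p.Prime).one_lt.ne' ?_
  refine Nat.dvd_one.1 (dvd_of_commutatorElement_eq_zElement_pow (g := 1) (h := 1) ?_)
  rw [h, one_pow, commutatorElement_one_left]

theorem classNumber_eq : classNumber (PiGroup p) = p * classNumber (PiTilde p) := by
  let f : PiGroup p →* PiTilde p := QuotientGroup.mk' _
  have hker : f.ker = Subgroup.zpowers (zElement p) :=
    (QuotientGroup.ker_mk' _).trans (normalClosure_zElement p)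
  rw [classNumber_eq_card_ker_mul (QuotientGroup.mk'_surjective _ : Function.Surjective f)
    (hker.trans_le (Subgroup.zpowers_le.2 (zElement_mem_center p))) fun g h hgh => ?_, hker,
    Nat.card_zpowers, orderOf_zElement]
  rw [hker, ← mem_powers_iff_mem_zpowers] at hgh
  obtain ⟨n, hn⟩ := hgh
  obtain ⟨m, rfl⟩ := dvd_of_commutatorElement_eq_zElement_pow hn.symm
  rw [← hn]
  exact (pow_mul _ _ _).trans (by rw [zElement_pow, one_pow])

end PiGroup

section FakeDegreeConjecture

variable (p : ℕ)

theorem isPGroup_piTilde : IsPGroup p (PiTilde p) :=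
  (PiGroup.isPGroup p).to_quotient _

variable [Fact p.Prime] (F : Type*) [Field F] [Finite F] [CharP F p]

theorem card_abelianization_normalizedUnits_piGroup_mul_le :
    Nat.card (Abelianization (NormalizedUnits F (PiGroup p))) *
        (Nat.card F ^ classNumber (PiTilde p) * p) ≤
      Nat.card (Abelianization (NormalizedUnits F (PiTilde p))) *
        Nat.card F ^ classNumber (PiGroup p) := by
  have hle : p * Nat.card (Abelianization (NormalizedUnits F (PiGroup p))) ≤
      Nat.card (Abelianization (NormalizedUnits F (PiTilde p))) *
        (Nat.card F ^ classNumber (PiTilde p)) ^ (p - 1) :=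
    card_abelianization_normalizedUnits_mul_le (PiGroup.zElement_mem_center p)
      (PiGroup.zElement_pow p) (PiGroup.zElement_mem_commutator p)
      (QuotientGroup.mk'_surjective _) fun g hg => by
        rwa [QuotientGroup.mk'_apply, QuotientGroup.eq_one_iff, PiGroup.normalClosure_zElement,
          ← mem_powers_iff_mem_zpowers] at hg
  calc Nat.card (Abelianization (NormalizedUnits F (PiGroup p))) *
        (Nat.card F ^ classNumber (PiTilde p) * p)
      = p * Nat.card (Abelianization (NormalizedUnits F (PiGroup p))) *
          Nat.card F ^ classNumber (PiTilde p) := by ring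
    _ ≤ Nat.card (Abelianization (NormalizedUnits F (PiTilde p))) *
          (Nat.card F ^ classNumber (PiTilde p)) ^ (p - 1) *
            Nat.card F ^ classNumber (PiTilde p) := Nat.mul_le_mul_right _ hle
    _ = Nat.card (Abelianization (NormalizedUnits F (PiTilde p))) *
          Nat.card F ^ classNumber (PiGroup p) := by
      rw [mul_assoc, pow_sub_one_mul (Fact.out : p.Prime).ne_zero, ← pow_mul,
        PiGroup.classNumber_eq, mul_comm p]

theorem not_hasFakeDegrees_piGroup_or_piTilde :
    ¬ HasFakeDegrees F (augmentationIdeal F (PiGroup p)) ∨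
      ¬ HasFakeDegrees F (augmentationIdeal F (PiTilde p)) := by
  by_contra! h
  have hle := card_abelianization_normalizedUnits_piGroup_mul_le p F
  obtain ⟨k, hk⟩ : ∃ k, classNumber (PiGroup p) = k + 1 :=
    Nat.exists_eq_add_one.2 Nat.card_pos
  obtain ⟨l, hl⟩ : ∃ l, classNumber (PiTilde p) = l + 1 :=
    Nat.exists_eq_add_one.2 Nat.card_pos
  have hadd : k + (l + 1) = l + (k + 1) := by ring
  rw [h.1.card_abelianization_normalizedUnits
      (isNilpotentAlgebra_augmentationIdeal (PiGroup.isPGroup p)),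
    h.2.card_abelianization_normalizedUnits
      (isNilpotentAlgebra_augmentationIdeal (isPGroup_piTilde p)), hk, hl,
    Nat.add_sub_cancel, Nat.add_sub_cancel, ← mul_assoc, ← pow_add, ← pow_add, hadd] at hle
  have hpos : 0 < Nat.card F ^ (l + (k + 1)) := pow_pos Nat.card_pos _
  exact (Fact.out : p.Prime).one_lt.not_ge (le_of_mul_le_mul_left (by simpa using hle) hpos)

end FakeDegreeConjecture

end FakeDegree

end

open FakeDegree in
theorem mainTheorem10_general (p : ℕ) [Fact p.Prime] (F : Type) [Field F] [Finite F] [CharP F p] :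
    ¬ FakeDegreeConjecture F ∧
    (Finite (augmentationIdeal F (PiGroup p)) ∧
      IsNilpotentAlgebra (augmentationIdeal F (PiGroup p)) ∧
      Finite (augmentationIdeal F (PiTilde p)) ∧
      IsNilpotentAlgebra (augmentationIdeal F (PiTilde p))) ∧
    (¬ HasFakeDegrees F (augmentationIdeal F (PiGroup p)) ∨
      ¬ HasFakeDegrees F (augmentationIdeal F (PiTilde p))) ∧
    (HasFakeDegrees F (augmentationIdeal F (PiGroup p)) →
      Nat.card (Abelianization (NormalizedUnits F (PiGroup p))) =
        Nat.card F ^ (classNumber (PiGroup p) - 1)) ∧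
    (HasFakeDegrees F (augmentationIdeal F (PiTilde p)) →
      Nat.card (Abelianization (NormalizedUnits F (PiTilde p))) =
        Nat.card F ^ (classNumber (PiTilde p) - 1)) ∧
    Nat.card (Abelianization (NormalizedUnits F (PiGroup p))) *
        (Nat.card F ^ classNumber (PiTilde p) * p) ≤
      Nat.card (Abelianization (NormalizedUnits F (PiTilde p))) *
        Nat.card F ^ classNumber (PiGroup p) := by
  have hnil := isNilpotentAlgebra_augmentationIdeal (F := F) (PiGroup.isPGroup p)
  have hnil' := isNilpotentAlgebra_augmentationIdeal (F := F) (isPGroup_piTilde p)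
  have hnot := not_hasFakeDegrees_piGroup_or_piTilde p F
  exact ⟨fun hconj => hnot.elim (· (hconj _ hnil)) (· (hconj _ hnil')),
    ⟨inferInstance, hnil, inferInstance, hnil'⟩, hnot,
    (·.card_abelianization_normalizedUnits hnil), (·.card_abelianization_normalizedUnits hnil'),
    card_abelianization_normalizedUnits_piGroup_mul_le p F⟩

theorem mainTheorem10 (p : ℕ) [Fact p.Prime] :
    -- the Fake Degree Conjecture fails for `F_p`-algebra groups
    ¬ FakeDegree.FakeDegreeConjecture (ZMod p) ∧
    -- the groups of normalized units of `F_p[π]` and `F_p[π/⟨z⟩]` are `F_p`-algebra groups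
    (Finite (FakeDegree.augmentationIdeal (ZMod p) (FakeDegree.PiGroup p)) ∧
      FakeDegree.IsNilpotentAlgebra
        (FakeDegree.augmentationIdeal (ZMod p) (FakeDegree.PiGroup p)) ∧
      Finite (FakeDegree.augmentationIdeal (ZMod p) (FakeDegree.PiTilde p)) ∧
      FakeDegree.IsNilpotentAlgebra
        (FakeDegree.augmentationIdeal (ZMod p) (FakeDegree.PiTilde p))) ∧
    -- and at least one of them violates the conjecture
    (¬ FakeDegree.HasFakeDegrees (ZMod p)
        (FakeDegree.augmentationIdeal (ZMod p) (FakeDegree.PiGroup p)) ∨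
      ¬ FakeDegree.HasFakeDegrees (ZMod p)
        (FakeDegree.augmentationIdeal (ZMod p) (FakeDegree.PiTilde p))) ∧
    -- the orders of the abelianizations that the conjecture would force
    (FakeDegree.HasFakeDegrees (ZMod p)
        (FakeDegree.augmentationIdeal (ZMod p) (FakeDegree.PiGroup p)) →
      Nat.card (Abelianization (FakeDegree.NormalizedUnits (ZMod p) (FakeDegree.PiGroup p))) =
        p ^ (FakeDegree.classNumber (FakeDegree.PiGroup p) - 1)) ∧
    (FakeDegree.HasFakeDegrees (ZMod p)
        (FakeDegree.augmentationIdeal (ZMod p) (FakeDegree.PiTilde p)) →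
      Nat.card (Abelianization (FakeDegree.NormalizedUnits (ZMod p) (FakeDegree.PiTilde p))) =
        p ^ (FakeDegree.classNumber (FakeDegree.PiTilde p) - 1)) ∧
    -- the bound on the order of the abelianization for `π` relative to that for `π/⟨z⟩`
    Nat.card (Abelianization (FakeDegree.NormalizedUnits (ZMod p) (FakeDegree.PiGroup p))) *
        p ^ (FakeDegree.classNumber (FakeDegree.PiTilde p) + 1) ≤
      Nat.card (Abelianization (FakeDegree.NormalizedUnits (ZMod p) (FakeDegree.PiTilde p))) *
        p ^ FakeDegree.classNumber (FakeDegree.PiGroup p) := by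
  simpa only [Nat.card_zmod, pow_succ] using mainTheorem10_general p (ZMod p)
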